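/- Theorem 4.2. Let $Y_1,Y_2,\ldots$ be i.i.d. observations with density $f$ with respect to a reference measure $\nu$ on a sample space $\mathcal Y$ (for example Lebesgue measure), and let $F$ be their distribution. Let $\{f(\cdot,\theta):\theta\in\Theta\}$ be a parametric family of probability densities with respect to $\nu$, where $\Theta\subseteq\mathbb R^p$ is open and convex and $\theta\mapsto\log f(y,\theta)\in[-\infty,\infty)$ is concave on $\Theta$ for each $y$. The true density $f$ need not belong to the family. Let $\theta_0\in\Theta$, and suppose that for all $t$ in some neighbourhood of $0$ we have $f(Y,\theta_0+t)>0$ almost surely (the null set may depend on $t$), and $$\log f(y,\theta_0+t)-\log f(y,\theta_0)=D(y)'t+R(y,t),$$ where $D:\mathcal Y\to\mathbb R^p$ has mean zero and finite covariance matrix under $F$, $R(Y,t)$ has finite second moment for all $t$ in a neighbourhood of $0$, and, as $t\to0$, $$\mathrm E\,R(Y,t)=-\tfrac12 t'Jt+o(|t|^2),\qquad \mathrm{Var}\,R(Y,t)=o(|t|^2),$$ for some symmetric positive definite matrix $J$. Let $\pi\ge0$ be a measurable, possibly improper, prior density on $\Theta$ which is continuous at $\theta_0$ with $\pi(\theta_0)>0$,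 and which satisfies $\pi(\theta)\le C_1\exp(C_2|\theta|)$ for all $\theta\in\Theta$, for some constants $C_1,C_2>0$. Let $L_n(\theta)=\prod_{i\le n}f(Y_i,\theta)$. Let $\hat\theta_n$ be a maximum likelihood estimator, that is, any random point which almost surely maximises $L_n$ over $\Theta$ whenever a maximiser exists. Let $$\theta_n^*=\frac{\int_\Theta\theta\,L_n(\theta)\pi(\theta)\,d\theta}{\int_\Theta L_n(\theta)\pi(\theta)\,d\theta}$$ be the posterior mean (with an arbitrary convention, such as $0$, where it is not defined). Then, with probability tending to one, $\hat\theta_n$ is a maximiser of $L_n$ over $\Theta$, and the posterior is a proper distribution with finite mean, that is, $0<\int_\Theta L_n\pi\,d\theta<\infty$ and $\int_\Theta|\theta|\,L_n(\theta)\pi(\theta)\,d\theta<\infty$. Moreover, $$\sqrt n\,(\theta_n^*-\hat\theta_n)\to_p 0.$$ (Where the events involved are not measurable, probabilities are outer probabilities.) -/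

import Mathlib

open MeasureTheory ProbabilityTheory Filter Topology Asymptotics
open scoped Matrix ENNReal

noncomputable section

namespace BayesML

/-- `g` is a probability density with respect to `ν`. -/
def IsProbDensity {𝒴 : Type*} [MeasurableSpace 𝒴] (ν : Measure 𝒴) (g : 𝒴 → ℝ) : Prop :=
  Measurable g ∧ (∀ y, 0 ≤ g y) ∧ ∫⁻ y, ENNReal.ofReal (g y) ∂ν = 1

/-- For a nonnegative function `g` on a convex set `Θ`: `log g` is concave on `Θ` as a function
with values in `[-∞, ∞)`, where `log 0 = -∞`. The inequality
`a log g(θ) + b log g(θ') ≤ log g(aθ + bθ')` is written in exponentiated form, with `a, b > 0`,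
so that zeros of `g` are treated correctly. -/
def LogConcaveOn {E : Type*} [AddCommGroup E] [Module ℝ E] (Θ : Set E) (g : E → ℝ) : Prop :=
  ∀ θ ∈ Θ, ∀ θ' ∈ Θ, ∀ a b : ℝ, 0 < a → 0 < b → a + b = 1 →
    g θ ^ a * g θ' ^ b ≤ g (a • θ + b • θ')

/-- The likelihood of the first `n` observations `y 0, …, y (n - 1)`. -/
def likelihood {𝒴 E : Type*} (f : 𝒴 → E → ℝ) (n : ℕ) (y : ℕ → 𝒴) (θ : E) : ℝ :=
  ∏ i ∈ Finset.range n, f (y i) θ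

/-- `θ` is a maximum likelihood estimate: it maximises the likelihood over `Θ`. -/
def IsMLE {𝒴 E : Type*} (Θ : Set E) (f : 𝒴 → E → ℝ) (n : ℕ) (y : ℕ → 𝒴) (θ : E) : Prop :=
  θ ∈ Θ ∧ ∀ θ' ∈ Θ, likelihood f n y θ' ≤ likelihood f n y θ

/-- The remainder `R(y, t) = log f(y, θ₀ + t) - log f(y, θ₀) - D(y)' t`. -/
def remainder {𝒴 : Type*} {p : ℕ} (f : 𝒴 → EuclideanSpace ℝ (Fin p) → ℝ)
    (θ₀ : EuclideanSpace ℝ (Fin p)) (D : 𝒴 → EuclideanSpace ℝ (Fin p))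
    (y : 𝒴) (t : EuclideanSpace ℝ (Fin p)) : ℝ :=
  Real.log (f y (θ₀ + t)) - Real.log (f y θ₀) - inner ℝ (D y) t

/-- The unnormalised posterior density `L_n(θ) π(θ)`. -/
def posteriorKernel {𝒴 E : Type*} (f : 𝒴 → E → ℝ) (prior : E → ℝ)
    (n : ℕ) (y : ℕ → 𝒴) (θ : E) : ℝ :=
  likelihood f n y θ * prior θ

/-- The posterior is a genuine probability distribution with a finite mean. -/
def PosteriorMeanExists {𝒴 : Type*} {p : ℕ} (Θ : Set (EuclideanSpace ℝ (Fin p)))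
    (f : 𝒴 → EuclideanSpace ℝ (Fin p) → ℝ) (prior : EuclideanSpace ℝ (Fin p) → ℝ)
    (n : ℕ) (y : ℕ → 𝒴) : Prop :=
  IntegrableOn (posteriorKernel f prior n y) Θ ∧
  0 < ∫ θ in Θ, posteriorKernel f prior n y θ ∧
  IntegrableOn (fun θ => posteriorKernel f prior n y θ • θ) Θ

/-- The posterior mean `∫ θ L_n(θ) π(θ) dθ / ∫ L_n(θ) π(θ) dθ`, integrals over `Θ`. -/
def posteriorMean {𝒴 : Type*} {p : ℕ} (Θ : Set (EuclideanSpace ℝ (Fin p)))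
    (f : 𝒴 → EuclideanSpace ℝ (Fin p) → ℝ) (prior : EuclideanSpace ℝ (Fin p) → ℝ)
    (n : ℕ) (y : ℕ → 𝒴) : EuclideanSpace ℝ (Fin p) :=
  (∫ θ in Θ, posteriorKernel f prior n y θ)⁻¹ •
    ∫ θ in Θ, posteriorKernel f prior n y θ • θ

end BayesML

end

namespace BayesML

/-! ### Log-concave functions: convexity, tails, measurability -/

section LogConcave

/-! Write θ = θ₀ + s/√n and u = n^(-1/2) ∑ D(Y_i). For fixed s the log-likelihood ratio is u's plus
a sum of n remainders R(Y_i, s/√n). That sum has mean tending to -s'Js/2 and variance tending to 0,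
so by Chebyshev the ratio is u's - s'Js/2 + o_P(1). Completing the square centres this quadratic at
J⁻¹u.

Log-concavity supplies the rest. It upgrades pointwise convergence to locally uniform convergence
(`eventually_abs_log_sub_lt`), confines maximisers to a neighbourhood of the centre
(`eventually_maximiser_near`), and forces exponential tails (`exists_exp_bound`). In the local scale
the prior tends to the constant π(θ₀) and grows at exponential rate at most C₂/√n, so dominated
convergence sends the local posterior mean to the centre (`tendsto_integral_and_moment`). Maximiser
and mean approach the same point, hence each other.

Probability is kept apart from analysis by a compactness argument:
`exists_closeEstimates_of_quadraticError` reduces the conclusion to a bound on ‖u‖ and good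
approximation at finitely many fixed s. Chebyshev and a union bound handle these, and no
measurability of the estimators is needed. -/

theorem LogConcaveOn.convex_superlevel {E : Type*} [AddCommGroup E] [Module ℝ E] {G : E → ℝ}
    (hG : LogConcaveOn Set.univ G) {c : ℝ} (hc : 0 < c) : Convex ℝ {s | c ≤ G s} := by
  rw [convex_iff_forall_pos]
  intro s hs t ht a b ha hb hab
  calc c = c ^ a * c ^ b := by rw [← Real.rpow_add hc, hab, Real.rpow_one]
    _ ≤ G s ^ a * G t ^ b := mul_le_mul (Real.rpow_le_rpow hc.le hs ha.le)
        (Real.rpow_le_rpow hc.le ht hb.le) (by positivity)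
        (Real.rpow_nonneg (hc.le.trans hs) _)
    _ ≤ _ := hG s trivial t trivial a b ha hb hab

theorem LogConcaveOn.convex_pos {E : Type*} [AddCommGroup E] [Module ℝ E] {G : E → ℝ}
    (hG : LogConcaveOn Set.univ G) : Convex ℝ {s | 0 < G s} := by
  rw [convex_iff_forall_pos]
  intro s hs t ht a b ha hb hab
  exact (mul_pos (Real.rpow_pos_of_pos hs a) (Real.rpow_pos_of_pos ht b)).trans_le
    (hG s trivial t trivial a b ha hb hab)

theorem LogConcaveOn.concaveOn_log {E : Type*} [AddCommGroup E] [Module ℝ E] {G : E → ℝ}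
    (hG : LogConcaveOn Set.univ G) : ConcaveOn ℝ {s | 0 < G s} (fun s => Real.log (G s)) := by
  rw [concaveOn_iff_forall_pos]
  refine ⟨hG.convex_pos, fun s hs t ht a b ha hb hab => ?_⟩
  have hs' := Real.rpow_pos_of_pos hs a
  have ht' := Real.rpow_pos_of_pos ht b
  rw [smul_eq_mul, smul_eq_mul, ← Real.log_rpow hs, ← Real.log_rpow ht,
    ← Real.log_mul hs'.ne' ht'.ne']
  exact Real.log_le_log (mul_pos hs' ht') (hG s trivial t trivial a b ha hb hab)

theorem LogConcaveOn.indicator {E : Type*} [AddCommGroup E] [Module ℝ E] {G : E → ℝ}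
    {S : Set E} (hS : Convex ℝ S) (hnn : ∀ s ∈ S, 0 ≤ G s) (hG : LogConcaveOn S G) :
    LogConcaveOn Set.univ (S.indicator G) := by
  intro s _ t _ a b ha hb hab
  have h0 : 0 ≤ S.indicator G (a • s + b • t) := Set.indicator_nonneg hnn _
  by_cases hs : s ∈ S
  · by_cases ht : t ∈ S
    · rw [Set.indicator_of_mem hs, Set.indicator_of_mem ht,
        Set.indicator_of_mem (hS hs ht ha.le hb.le hab)]
      exact hG s hs t ht a b ha hb hab
    · rwa [Set.indicator_of_notMem ht, Real.zero_rpow hb.ne', mul_zero]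
  · rwa [Set.indicator_of_notMem hs, Real.zero_rpow ha.ne', zero_mul]

theorem LogConcaveOn.prod {E ι : Type*} [AddCommGroup E] [Module ℝ E] {S : Set E}
    {g : ι → E → ℝ} (I : Finset ι) (hnn : ∀ i ∈ I, ∀ s ∈ S, 0 ≤ g i s)
    (hg : ∀ i ∈ I, LogConcaveOn S (g i)) : LogConcaveOn S (fun s => ∏ i ∈ I, g i s) := by
  intro s hs t ht a b ha hb hab
  rw [← Real.finsetProd_rpow I _ fun i hi => hnn i hi s hs,
    ← Real.finsetProd_rpow I _ fun i hi => hnn i hi t ht, ← Finset.prod_mul_distrib]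
  exact Finset.prod_le_prod (fun i hi => mul_nonneg (Real.rpow_nonneg (hnn i hi s hs) _)
    (Real.rpow_nonneg (hnn i hi t ht) _)) fun i hi => hg i hi s hs t ht a b ha hb hab

theorem LogConcaveOn.const_mul_comp_affine {E : Type*} [AddCommGroup E] [Module ℝ E] {G : E → ℝ}
    (hnn : ∀ s, 0 ≤ G s) (hG : LogConcaveOn Set.univ G) {c : ℝ} (hc : 0 < c) (x : E) (r : ℝ) :
    LogConcaveOn Set.univ (fun s => c * G (x + r • s)) := by
  intro s _ t _ a b ha hb hab
  have hx : x + r • (a • s + b • t) = a • (x + r • s) + b • (x + r • t) := by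
    have : x = (a + b) • x := by rw [hab, one_smul]
    nth_rewrite 1 [this]
    module
  simp only [hx]
  rw [Real.mul_rpow hc.le (hnn _), Real.mul_rpow hc.le (hnn _)]
  calc c ^ a * G (x + r • s) ^ a * (c ^ b * G (x + r • t) ^ b)
      = c ^ (a + b) * (G (x + r • s) ^ a * G (x + r • t) ^ b) := by
        rw [Real.rpow_add hc]; ring
    _ ≤ _ := by
        rw [hab, Real.rpow_one]
        exact mul_le_mul_of_nonneg_left (hG _ trivial _ trivial a b ha hb hab) hc.le

/-- A log-concave function that is smaller on a sphere than at its centre is smaller outside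
the sphere as well. -/
theorem LogConcaveOn.lt_of_lt_on_sphere {E : Type*} [NormedAddCommGroup E] [NormedSpace ℝ E]
    {G : E → ℝ} (hG : LogConcaveOn Set.univ G) {a : E} (ha : 0 < G a) {ε : ℝ} (hε : 0 < ε)
    (h : ∀ s, ‖s - a‖ = ε → G s < G a) {x : E} (hx : ε ≤ ‖x - a‖) : G x < G a := by
  by_contra! hxa
  have hpos : 0 < ‖x - a‖ := hε.trans_le hx
  have ht : ε / ‖x - a‖ ≤ 1 := (div_le_one hpos).2 hx
  -- The superlevel set at height `G a` is convex, so it contains the point where the segment from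
  -- `a` to `x` crosses the sphere.
  have hmem := (hG.convex_superlevel ha) (le_refl (G a)) hxa (sub_nonneg.2 ht)
    (div_nonneg hε.le hpos.le) (by ring)
  refine absurd hmem (not_le.2 (h _ ?_))
  have : (1 - ε / ‖x - a‖) • a + (ε / ‖x - a‖) • x - a = (ε / ‖x - a‖) • (x - a) := by module
  rw [this, norm_smul, Real.norm_of_nonneg (div_nonneg hε.le hpos.le), div_mul_cancel₀ _ hpos.ne']

/-- A log-concave function that drops from `1` at the origin to `e⁻¹` on a sphere decays
exponentially outside the sphere. -/
theorem LogConcaveOn.le_exp_of_le_on_sphere {E : Type*} [NormedAddCommGroup E] [NormedSpace ℝ E]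
    {G : E → ℝ} (hnn : ∀ s, 0 ≤ G s) (hG : LogConcaveOn Set.univ G) (h0 : G 0 = 1)
    {M : ℝ} (hM : 0 < M) (h : ∀ s, ‖s‖ = M → G s ≤ Real.exp (-1)) {s : E} (hs : M ≤ ‖s‖) :
    G s ≤ Real.exp (-(‖s‖ / M)) := by
  have hpos : 0 < ‖s‖ := hM.trans_le hs
  have hb : 0 < M / ‖s‖ := div_pos hM hpos
  -- `LogConcaveOn` requires both weights to be strictly positive, so the sphere itself is treated
  -- separately.
  rcases hs.eq_or_lt with hs' | hs'
  · rw [← hs', div_self hM.ne']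
    exact h s hs'.symm
  have key := hG 0 trivial s trivial (1 - M / ‖s‖) (M / ‖s‖)
    (sub_pos.2 ((div_lt_one hpos).2 hs')) hb (by ring)
  rw [h0, Real.one_rpow, one_mul, smul_zero, zero_add] at key
  have h1 : G s ^ (M / ‖s‖) ≤ Real.exp (-1) := by
    refine key.trans (h _ ?_)
    rw [norm_smul, Real.norm_of_nonneg hb.le, div_mul_cancel₀ _ hpos.ne']
  have h2 := Real.rpow_le_rpow (Real.rpow_nonneg (hnn s) _) h1 (inv_pos.2 hb).le
  rw [← Real.rpow_mul (hnn s), mul_inv_cancel₀ hb.ne', Real.rpow_one, ← Real.exp_mul] at h2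
  convert h2 using 2
  rw [inv_div]; ring

theorem LogConcaveOn.continuousOn_interior {E : Type*} [NormedAddCommGroup E] [NormedSpace ℝ E]
    [FiniteDimensional ℝ E] {G : E → ℝ} (hG : LogConcaveOn Set.univ G) :
    ContinuousOn G (interior {s | 0 < G s}) := by
  refine (hG.concaveOn_log.continuousOn_interior.rexp).congr fun s hs => ?_
  exact (Real.exp_log (show 0 < G s from interior_subset (s := {s | 0 < G s}) hs)).symm

/-- `G` is continuous on the interior of its convex positivity set and zero off the closure; the
frontier of a convex set is Haar-null, so its values there are irrelevant. -/
theorem LogConcaveOn.aestronglyMeasurable {E : Type*} [NormedAddCommGroup E] [NormedSpace ℝ E]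
    [FiniteDimensional ℝ E] [MeasurableSpace E] [BorelSpace E] (μ : Measure E)
    [μ.IsAddHaarMeasure] {G : E → ℝ} (hnn : ∀ s, 0 ≤ G s) (hG : LogConcaveOn Set.univ G) :
    AEStronglyMeasurable G μ := by
  have hm : MeasurableSet (interior {s | 0 < G s}) := isOpen_interior.measurableSet
  have h1 : AEStronglyMeasurable ((interior {s | 0 < G s}).indicator G) μ :=
    (aestronglyMeasurable_indicator_iff hm).2 (hG.continuousOn_interior.aestronglyMeasurable hm)
  refine h1.congr ?_
  have h2 : ∀ᵐ s ∂μ, s ∉ frontier {s | 0 < G s} :=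
    measure_eq_zero_iff_ae_notMem.1 (hG.convex_pos.addHaar_frontier μ)
  filter_upwards [h2] with s hs
  by_cases hi : s ∈ interior {s | 0 < G s}
  · rw [Set.indicator_of_mem hi]
  · rw [Set.indicator_of_notMem hi]
    have : s ∉ {s | 0 < G s} := fun h => hs ⟨subset_closure h, hi⟩
    exact le_antisymm (hnn s) (not_lt.1 this)

end LogConcave

/-! ### From pointwise to locally uniform convergence -/

section LocallyUniform

/-- There is a dense sequence whose finite subsets have arbitrarily large convex hulls. -/
theorem exists_denseRange_convexHull (E : Type*) [NormedAddCommGroup E] [NormedSpace ℝ E]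
    [FiniteDimensional ℝ E] : ∃ q : ℕ → E, DenseRange q ∧
      ∀ R : ℝ, ∃ T : Finset E, (T : Set E) ⊆ Set.range q ∧
        Metric.closedBall 0 R ⊆ convexHull ℝ (T : Set E) := by
  classical
  obtain ⟨b, hb, -⟩ := exists_mem_interior_convexHull_affineBasis
    (univ_mem : (Set.univ : Set E) ∈ 𝓝 0)
  obtain ⟨r, hr, hrb⟩ := Metric.nhds_basis_closedBall.mem_iff.1 (mem_interior_iff_mem_nhds.1 hb)
  let T : Finset E := Finset.univ.image b
  have hT : (T : Set E) = Set.range b := by simp [T]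
  -- A dense sequence, enlarged by all integer dilates of the vertices of one simplex around the
  -- origin.
  let Q : Set E := Set.range (TopologicalSpace.denseSeq E) ∪ {0} ∪
    ⋃ k : ℕ, (fun v => (k : ℝ) • v) '' (T : Set E)
  have hQc : Q.Countable := ((Set.countable_range _).union (Set.countable_singleton 0)).union
    (Set.countable_iUnion fun k => (T.countable_toSet.image _))
  obtain ⟨q, hq⟩ := hQc.exists_eq_range ⟨0, Or.inl (Or.inr rfl)⟩
  refine ⟨q, ?_, fun R => ?_⟩
  · rw [DenseRange, ← hq]
    exact (TopologicalSpace.denseRange_denseSeq E).mono fun x hx => Or.inl (Or.inl hx)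
  · obtain ⟨k, hk⟩ := exists_nat_gt (max (R / r) 0)
    have hk0 : (0 : ℝ) < k := (le_max_right _ _).trans_lt hk
    have hkR : R < k * r := (div_lt_iff₀ hr).1 ((le_max_left _ _).trans_lt hk)
    refine ⟨T.image fun v => (k : ℝ) • v, ?_, ?_⟩
    · rw [← hq, Finset.coe_image]
      exact fun x hx => Or.inr (Set.mem_iUnion.2 ⟨k, hx⟩)
    · rw [Finset.coe_image, Set.image_smul, convexHull_smul, hT]
      intro x hx
      rw [Set.mem_smul_set_iff_inv_smul_mem₀ hk0.ne']
      refine hrb ?_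
      rw [mem_closedBall_zero_iff] at hx ⊢
      rw [norm_smul, norm_inv, Real.norm_of_nonneg hk0.le, inv_mul_le_iff₀ hk0]
      exact hx.trans hkR.le

/-- Log-concave functions whose logarithms converge on a dense set that contains the vertices of
arbitrarily large polytopes converge uniformly on balls. -/
theorem eventually_abs_log_sub_lt {E : Type*} [NormedAddCommGroup E] [NormedSpace ℝ E]
    [FiniteDimensional ℝ E] {G : ℕ → E → ℝ} (hconc : ∀ m, LogConcaveOn Set.univ (G m))
    (h0 : ∀ m, G m 0 = 1) {φ : E → ℝ} (hφ : Continuous φ) {q : ℕ → E} (hq : DenseRange q)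
    (hqT : ∀ R : ℝ, ∃ T : Finset E, (T : Set E) ⊆ Set.range q ∧
        Metric.closedBall 0 R ⊆ convexHull ℝ (T : Set E))
    (hpos : ∀ j, ∀ᶠ m in atTop, 0 < G m (q j))
    (hlim : ∀ j, Tendsto (fun m => Real.log (G m (q j))) atTop (𝓝 (φ (q j))))
    (R : ℝ) {η : ℝ} (hη : 0 < η) :
    ∀ᶠ m in atTop, ∀ s, ‖s‖ ≤ R → 0 < G m s ∧ |Real.log (G m s) - φ s| < η := by
  -- One unit of margin is spent on the Lipschitz estimate, the other on dense points `q j` just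
  -- outside the ball of radius `R`.
  obtain ⟨T, hTq, hTR⟩ := hqT (R + 2)
  obtain ⟨B, hBpos, hB⟩ : ∃ B : ℝ, 0 < B ∧ ∀ v ∈ T, |φ v| ≤ B := by
    refine ⟨1 + ∑ v ∈ T, |φ v|, by positivity, fun v hv => ?_⟩
    have := Finset.single_le_sum (f := fun v => |φ v|) (fun i _ => abs_nonneg _) hv
    linarith
  have hbdd : ∀ᶠ m in atTop, ∀ s, ‖s‖ ≤ R + 2 → 0 < G m s ∧ |Real.log (G m s)| ≤ B + 1 := by
    have hv : ∀ᶠ m in atTop, ∀ v ∈ T, Real.exp (-(B + 1)) ≤ G m v := by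
      rw [Filter.eventually_all_finset]
      intro v hv
      obtain ⟨j, rfl⟩ := hTq hv
      have hl : -(B + 1) < φ (q j) := by linarith [(abs_le.1 (hB _ hv)).1]
      filter_upwards [hpos j, (hlim j).eventually (lt_mem_nhds hl)] with m hm1 hm2
      exact ((Real.lt_log_iff_exp_lt hm1).1 hm2).le
    filter_upwards [hv] with m hm s hs
    have hge : ∀ s, ‖s‖ ≤ R + 2 → Real.exp (-(B + 1)) ≤ G m s := fun s hs =>
      convexHull_min (fun v hv => hm v hv) ((hconc m).convex_superlevel (Real.exp_pos _))
        (hTR (mem_closedBall_zero_iff.2 hs))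
    have h1 := hge s hs
    -- The upper bound comes from reflection: concavity at the midpoint 0, where the log vanishes,
    -- gives log G(s) ≤ -log G(-s).
    have h2 := hge (-s) (by rwa [norm_neg])
    have p1 := (Real.exp_pos _).trans_le h1
    have p2 := (Real.exp_pos _).trans_le h2
    have l1 := (Real.le_log_iff_exp_le p1).2 h1
    have l2 := (Real.le_log_iff_exp_le p2).2 h2
    have half : (0 : ℝ) ≤ 1 / 2 := by norm_num
    have hc := (hconc m).concaveOn_log.2 p1 p2 half half (by norm_num)
    simp only [smul_neg, add_neg_cancel, h0, Real.log_one, smul_eq_mul] at hc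
    exact ⟨p1, abs_le.2 ⟨l1, by linarith⟩⟩
  have hLip : ∀ᶠ m in atTop, (∀ s, ‖s‖ ≤ R + 2 → 0 < G m s) ∧
      LipschitzOnWith (2 * (B + 1) / 1).toNNReal (fun s => Real.log (G m s))
        (Metric.ball 0 (R + 2 - 1)) := by
    filter_upwards [hbdd] with m hm
    refine ⟨fun s hs => (hm s hs).1, ConcaveOn.lipschitzOnWith_of_abs_le ?_ one_pos ?_⟩
    · exact (hconc m).concaveOn_log.subset
        (fun s hs => (hm s (mem_ball_zero_iff.1 hs).le).1) (convex_ball _ _)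
    · intro s hs
      exact (hm s (by rw [← dist_zero_right]; exact hs.le)).2
  have hlocal : ∀ x ∈ Metric.closedBall (0 : E) R, ∃ U ∈ 𝓝[Metric.closedBall (0 : E) R] x,
      ∀ᶠ m in atTop, ∀ s ∈ U, ‖s‖ ≤ R → |Real.log (G m s) - φ s| < η := by
    intro x hx
    obtain ⟨d, hd, hdφ⟩ := Metric.continuousAt_iff.1 (hφ.continuousAt (x := x)) (η / 8) (by positivity)
    set K : ℝ := 2 * (B + 1) with hK
    have hKpos : 0 < K := by positivity
    -- The Lipschitz term costs at most 2Kρ ≤ η/4, and convergence at `q j` and two moves of φ cost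
    -- η/8 each: 5η/8 in total.
    set ρ := min (min d 1) (η / (8 * K)) with hρ
    have hρpos : 0 < ρ := by positivity
    have hρd : ρ ≤ d := (min_le_left _ _).trans (min_le_left _ _)
    have hρ1 : ρ ≤ 1 := (min_le_left _ _).trans (min_le_right _ _)
    have hρK : K * ρ ≤ η / 8 := by
      have : ρ ≤ η / (8 * K) := min_le_right _ _
      rw [le_div_iff₀ (by positivity)] at this
      linarith
    obtain ⟨j, hj⟩ := hq.exists_dist_lt x hρpos
    rw [dist_comm] at hj
    refine ⟨Metric.ball x ρ, mem_nhdsWithin_of_mem_nhds (Metric.ball_mem_nhds x hρpos), ?_⟩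
    have hl := (Metric.tendsto_nhds.1 (hlim j)) (η / 8) (by positivity)
    filter_upwards [hLip, hl] with m hm hmj s hs hsR
    have hxn := mem_closedBall_zero_iff.1 hx
    have hqR : q j ∈ Metric.ball (0 : E) (R + 2 - 1) := by
      rw [mem_ball_zero_iff]
      have := norm_sub_norm_le (q j) x
      rw [← dist_eq_norm] at this
      linarith
    have hsR' : s ∈ Metric.ball (0 : E) (R + 2 - 1) := by
      rw [mem_ball_zero_iff]; linarith
    have e1 := hm.2.dist_le_mul s hsR' (q j) hqR
    rw [div_one, Real.coe_toNNReal _ hKpos.le] at e1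
    have e2 : dist s (q j) ≤ 2 * ρ := by
      have := dist_triangle s x (q j)
      rw [Metric.mem_ball] at hs
      rw [dist_comm] at hj
      linarith
    have e3 := mul_le_mul_of_nonneg_left e2 hKpos.le
    have e4 := hdφ (hs.trans_le hρd)
    have e5 := hdφ (hj.trans_le hρd)
    simp only [Real.dist_eq] at e1 hmj e4 e5
    rw [abs_lt] at *
    rw [abs_le] at e1
    constructor <;> linarith [e1.1, e1.2, hmj.1, hmj.2, e4.1, e4.2, e5.1, e5.2]
  have hunif : ∀ᶠ m in atTop, ∀ s ∈ Metric.closedBall (0 : E) R, ‖s‖ ≤ R →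
      |Real.log (G m s) - φ s| < η := by
    refine (isCompact_closedBall (0 : E) R).induction_on
      (p := fun U => ∀ᶠ m in atTop, ∀ s ∈ U, ‖s‖ ≤ R → |Real.log (G m s) - φ s| < η)
      (by simp) (fun U V hUV hV => ?_) (fun U V hU hV => ?_) hlocal
    · filter_upwards [hV] with m hm s hs using hm s (hUV hs)
    · filter_upwards [hU, hV] with m hm hm' s hs
      exact hs.elim (hm s) (hm' s)
  filter_upwards [hunif, hLip] with m hm hm' s hs
  exact ⟨hm'.1 s (by linarith), hm s (mem_closedBall_zero_iff.2 hs) hs⟩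

end LocallyUniform

/-! ### Maximisers, integrals and moments under a quadratic limit -/

section GaussianLimit

variable {E : Type*} [NormedAddCommGroup E] [NormedSpace ℝ E]
  {G : ℕ → E → ℝ} {B : E → ℝ} {a : E} {κ c : ℝ}

/-- On a large sphere the quadratic limit forces log G ≤ -1, and log-concavity propagates this
outward at a rate 1/M independent of m. Inside the sphere the constant `A` absorbs the bound. -/
theorem exists_exp_bound (hconc : ∀ m, LogConcaveOn Set.univ (G m)) (hnn : ∀ m s, 0 ≤ G m s)
    (h0 : ∀ m, G m 0 = 1) (hc : 0 < c) (hB : ∀ s, c * ‖s‖ ^ 2 ≤ B s)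
    (hunif : ∀ R η : ℝ, 0 < η → ∀ᶠ m in atTop, ∀ s, ‖s‖ ≤ R →
      0 < G m s ∧ |Real.log (G m s) - (κ - 1 / 2 * B (s - a))| < η) :
    ∃ A > 0, ∃ M > 0, ∀ᶠ m in atTop, ∀ s, G m s ≤ A * Real.exp (-(‖s‖ / M)) := by
  obtain ⟨t, ht1, ht⟩ : ∃ t : ℝ, 1 ≤ t ∧ |κ| + 2 ≤ 1 / 2 * (c * t ^ 2) := by
    refine ⟨max 1 (2 * (|κ| + 2) / c), le_max_left _ _, ?_⟩
    set t := max 1 (2 * (|κ| + 2) / c)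
    have h1 : 1 ≤ t := le_max_left _ _
    have h2 : 2 * (|κ| + 2) / c ≤ t := le_max_right _ _
    rw [div_le_iff₀ hc] at h2
    nlinarith [mul_le_mul_of_nonneg_left h1 (mul_pos hc (zero_lt_one.trans_le h1)).le]
  have hM : 0 < ‖a‖ + t := by positivity
  refine ⟨Real.exp (|κ| + 2), Real.exp_pos _, ‖a‖ + t, hM, ?_⟩
  filter_upwards [hunif (‖a‖ + t) 1 one_pos] with m hm s
  by_cases hs : ‖s‖ ≤ ‖a‖ + t
  · obtain ⟨h1, h2⟩ := hm s hs
    have h3 : 0 ≤ B (s - a) := le_trans (by positivity) (hB (s - a))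
    rw [← Real.exp_log h1, ← Real.exp_add, Real.exp_le_exp]
    have h4 : ‖s‖ / (‖a‖ + t) ≤ 1 := (div_le_one hM).2 hs
    linarith [(abs_lt.1 h2).2, le_abs_self κ]
  · refine ((hconc m).le_exp_of_le_on_sphere (hnn m) (h0 m) hM (fun x hx => ?_)
      (not_le.1 hs).le).trans ?_
    · obtain ⟨h1, h2⟩ := hm x hx.le
      rw [← Real.exp_log h1, Real.exp_le_exp]
      have h3 : t ≤ ‖x - a‖ := by
        have := norm_sub_norm_le x a
        linarith
      have h4 : c * t ^ 2 ≤ c * ‖x - a‖ ^ 2 := by gcongr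
      linarith [(abs_lt.1 h2).2, le_abs_self κ, hB (x - a)]
    · exact le_mul_of_one_le_left (Real.exp_pos _).le (Real.one_le_exp (by positivity))

variable [FiniteDimensional ℝ E]

/-- Comparison with (1 + ‖s‖)^(-(dim + 1)), using x^k/k! ≤ eˣ with k = dim + 2; the extra power pays
for the first-moment factor. -/
theorem integrable_one_add_norm_mul_exp_neg [MeasurableSpace E] [BorelSpace E] (μ : Measure E)
    [μ.IsAddHaarMeasure] {c : ℝ} (hc : 0 < c) :
    Integrable (fun s : E => (1 + ‖s‖) * Real.exp (-(c * ‖s‖))) μ := by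
  set k := Module.finrank ℝ E + 2 with hk
  have hJ := (integrable_one_add_norm (E := E) (μ := μ) (r := (Module.finrank ℝ E + 1 : ℕ))
    (by push_cast; linarith)).const_mul (Real.exp c * (k.factorial / c ^ k))
  refine hJ.mono' (by fun_prop) (ae_of_all _ fun s => ?_)
  have hs : 0 < 1 + ‖s‖ := by positivity
  rw [Real.norm_of_nonneg (by positivity), Real.rpow_neg hs.le, Real.rpow_natCast]
  have h1 := Real.pow_div_factorial_le_exp (c * (1 + ‖s‖)) (by positivity) k
  have h2 : Real.exp (-(c * ‖s‖)) = Real.exp c * (Real.exp (c * (1 + ‖s‖)))⁻¹ := by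
    rw [← Real.exp_neg, ← Real.exp_add]; ring_nf
  have h3 : (Real.exp (c * (1 + ‖s‖)))⁻¹ ≤ ((c * (1 + ‖s‖)) ^ k / k.factorial)⁻¹ :=
    inv_anti₀ (by positivity) h1
  calc (1 + ‖s‖) * Real.exp (-(c * ‖s‖))
      ≤ (1 + ‖s‖) * (Real.exp c * ((c * (1 + ‖s‖)) ^ k / k.factorial)⁻¹) := by
        rw [h2]; gcongr
    _ = _ := by
        have : (1 + ‖s‖) ^ k = (1 + ‖s‖) ^ (Module.finrank ℝ E + 1) * (1 + ‖s‖) := by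
          rw [← pow_succ]
        rw [mul_pow, this]
        field_simp

/-- A Gaussian-type density `exp (κ - B (s - a) / 2)` with `B` even has mean `a`. -/
theorem integral_exp_even_smul [MeasurableSpace E] [BorelSpace E] (μ : Measure E)
    [μ.IsAddHaarMeasure] (hBeven : ∀ s, B (-s) = B s) (a : E) (κ : ℝ)
    (hint : Integrable (fun s => Real.exp (κ - 1 / 2 * B (s - a))) μ)
    (hint' : Integrable (fun s => Real.exp (κ - 1 / 2 * B (s - a)) • s) μ) :
    ∫ s, Real.exp (κ - 1 / 2 * B (s - a)) • s ∂μ =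
      (∫ s, Real.exp (κ - 1 / 2 * B (s - a)) ∂μ) • a := by
  have hodd : ∫ s, Real.exp (κ - 1 / 2 * B s) • s ∂μ = 0 := by
    have h := integral_neg_eq_self (fun s => Real.exp (κ - 1 / 2 * B s) • s) μ
    simp only [hBeven, smul_neg, integral_neg] at h
    have h2 : (2 : ℝ) • ∫ s, Real.exp (κ - 1 / 2 * B s) • s ∂μ = 0 := by
      rw [two_smul]
      nth_rewrite 1 [← h]
      exact neg_add_cancel _
    exact (smul_eq_zero.1 h2).resolve_left two_ne_zero
  have hcent : ∫ s, Real.exp (κ - 1 / 2 * B (s - a)) • (s - a) ∂μ = 0 := by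
    rw [integral_sub_right_eq_self (fun s => Real.exp (κ - 1 / 2 * B s) • s) a, hodd]
  simp only [smul_sub] at hcent
  rw [integral_sub hint' (hint.smul_const a), integral_smul_const] at hcent
  exact sub_eq_zero.1 hcent

/-- Maximisers of log-concave functions with a quadratic limit exist and converge to the centre of
the limit. -/
theorem eventually_maximiser_near (hconc : ∀ m, LogConcaveOn Set.univ (G m))
    (hB0 : B 0 = 0) (hc : 0 < c) (hB : ∀ s, c * ‖s‖ ^ 2 ≤ B s)
    (hunif : ∀ R η : ℝ, 0 < η → ∀ᶠ m in atTop, ∀ s, ‖s‖ ≤ R →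
      0 < G m s ∧ |Real.log (G m s) - (κ - 1 / 2 * B (s - a))| < η)
    {ε : ℝ} (hε : 0 < ε) :
    ∀ᶠ m in atTop, (∃ s, ∀ t, G m t ≤ G m s) ∧
      ∀ s, (∀ t, G m t ≤ G m s) → ‖s - a‖ < ε := by
  -- At distance ε from `a` the limit has dropped by at least cε²/2, while the two approximation
  -- errors total less than cε²/4.
  filter_upwards [hunif (‖a‖ + 2 * ε) (c * ε ^ 2 / 8) (by positivity)] with m hm
  have ha := hm a (by linarith)
  have hball : ∀ s, ‖s - a‖ ≤ ε → ‖s‖ < ‖a‖ + 2 * ε := fun s hs => by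
    have := norm_sub_norm_le s a
    linarith
  have hsphere : ∀ s, ‖s - a‖ = ε → G m s < G m a := by
    intro s hs
    have h1 := hm s (hball s hs.le).le
    have h2 := hB (s - a)
    have h3 : 0 < c * ε ^ 2 := by positivity
    rw [hs] at h2
    rw [← Real.log_lt_log_iff h1.1 ha.1]
    have e1 := (abs_lt.1 h1.2).2
    have e2 := (abs_lt.1 ha.2).1
    rw [sub_self, hB0] at e2
    linarith
  have hout : ∀ x, ε ≤ ‖x - a‖ → G m x < G m a := fun x hx =>
    (hconc m).lt_of_lt_on_sphere ha.1 hε hsphere hx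
  constructor
  · have hsub : Metric.closedBall a ε ⊆ interior {s | 0 < G m s} := by
      refine Set.Subset.trans ?_ (interior_mono
        (s := Metric.ball 0 (‖a‖ + 2 * ε)) fun s hs => ?_)
      · rw [Metric.isOpen_ball.interior_eq]
        intro s hs
        rw [mem_ball_zero_iff]
        exact hball s (by simpa [dist_eq_norm] using hs)
      · exact (hm s (mem_ball_zero_iff.1 hs).le).1
    obtain ⟨s, -, hs⟩ := (isCompact_closedBall a ε).exists_isMaxOn
      ⟨a, Metric.mem_closedBall_self hε.le⟩ ((hconc m).continuousOn_interior.mono hsub)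
    refine ⟨s, fun t => ?_⟩
    by_cases ht : ‖t - a‖ ≤ ε
    · exact hs (by simpa [dist_eq_norm] using ht)
    · exact (hout t (not_le.1 ht).le).le.trans (hs (Metric.mem_closedBall_self hε.le))
  · intro s hs
    by_contra! h
    exact absurd (hs a) (not_le.2 (hout s h))

/-- Integrals and first moments of log-concave functions with a quadratic limit, weighted by
functions of small exponential growth that converge to a positive constant. -/
theorem tendsto_integral_and_moment [MeasurableSpace E] [BorelSpace E] (μ : Measure E)
    [μ.IsAddHaarMeasure] (hconc : ∀ m, LogConcaveOn Set.univ (G m)) (hnn : ∀ m s, 0 ≤ G m s)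
    (h0 : ∀ m, G m 0 = 1) (hBc : Continuous B) (hBeven : ∀ s, B (-s) = B s) (hc : 0 < c)
    (hB : ∀ s, c * ‖s‖ ^ 2 ≤ B s)
    (hunif : ∀ R η : ℝ, 0 < η → ∀ᶠ m in atTop, ∀ s, ‖s‖ ≤ R →
      0 < G m s ∧ |Real.log (G m s) - (κ - 1 / 2 * B (s - a))| < η)
    {w : ℕ → E → ℝ} (hwm : ∀ m, AEStronglyMeasurable (w m) μ) (hwnn : ∀ m s, 0 ≤ w m s)
    {C : ℝ} {δ : ℕ → ℝ} (hδ : Tendsto δ atTop (𝓝 0))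
    (hwC : ∀ m s, w m s ≤ C * Real.exp (δ m * ‖s‖))
    {w₀ : ℝ} (hw₀ : 0 < w₀) (hwlim : ∀ s, Tendsto (fun m => w m s) atTop (𝓝 w₀)) :
    (∀ᶠ m in atTop, Integrable (fun s => G m s * w m s) μ ∧
      Integrable (fun s => (G m s * w m s) • s) μ) ∧
    ∃ Z > 0, Tendsto (fun m => ∫ s, G m s * w m s ∂μ) atTop (𝓝 Z) ∧
      Tendsto (fun m => ∫ s, (G m s * w m s) • s ∂μ) atTop (𝓝 (Z • a)) := by
  obtain ⟨A, hA, M, hM, hexp⟩ := exists_exp_bound hconc hnn h0 hc hB hunif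
  have hC : 0 ≤ C := by
    have := (hwnn 0 0).trans (hwC 0 0)
    simpa using this
  -- Half of the decay rate 1/M is given up to beat the growth `δ m` of the weights; the factor 1 +
  -- ‖s‖ dominates mass and first moment at once.
  set bd : E → ℝ := fun s => A * C * ((1 + ‖s‖) * Real.exp (-(1 / (2 * M) * ‖s‖))) with hbd
  have hbdi : Integrable bd μ :=
    (integrable_one_add_norm_mul_exp_neg μ (by positivity)).const_mul _
  have hdom : ∀ᶠ m in atTop, ∀ s, (1 + ‖s‖) * (G m s * w m s) ≤ bd s := by
    filter_upwards [hexp, hδ.eventually (gt_mem_nhds (show 0 < 1 / (2 * M) by positivity))]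
      with m hm hδm s
    have e1 : G m s * w m s ≤ (A * Real.exp (-(‖s‖ / M))) * (C * Real.exp (δ m * ‖s‖)) :=
      mul_le_mul (hm s) (hwC m s) (hwnn m s) (by positivity)
    have e2 : Real.exp (-(‖s‖ / M)) * Real.exp (δ m * ‖s‖) ≤
        Real.exp (-(1 / (2 * M) * ‖s‖)) := by
      rw [← Real.exp_add, Real.exp_le_exp]
      have := mul_le_mul_of_nonneg_right hδm.le (norm_nonneg s)
      have h2 : ‖s‖ / M = 1 / (2 * M) * ‖s‖ + 1 / (2 * M) * ‖s‖ := by field_simp; ring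
      linarith
    have e3 := mul_le_mul_of_nonneg_left e2 (mul_nonneg hA.le hC)
    calc _ ≤ (1 + ‖s‖) * (A * C * Real.exp (-(1 / (2 * M) * ‖s‖))) := by
            exact mul_le_mul_of_nonneg_left (by linarith) (by positivity)
      _ = bd s := by rw [hbd]; ring
  have hGm : ∀ m, AEStronglyMeasurable (G m) μ := fun m =>
    (hconc m).aestronglyMeasurable μ (hnn m)
  have hm1 : ∀ m, AEStronglyMeasurable (fun s => G m s * w m s) μ := fun m =>
    (hGm m).mul (hwm m)
  have hm2 : ∀ m, AEStronglyMeasurable (fun s => (G m s * w m s) • s) μ := fun m =>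
    (hm1 m).smul aestronglyMeasurable_id
  have hb1 : ∀ᶠ m in atTop, ∀ s, ‖G m s * w m s‖ ≤ bd s := by
    filter_upwards [hdom] with m hm s
    have hp := mul_nonneg (hnn m s) (hwnn m s)
    rw [Real.norm_of_nonneg hp]
    nlinarith [hm s, mul_nonneg (norm_nonneg s) hp]
  have hb2 : ∀ᶠ m in atTop, ∀ s, ‖(G m s * w m s) • s‖ ≤ bd s := by
    filter_upwards [hdom] with m hm s
    have hp := mul_nonneg (hnn m s) (hwnn m s)
    rw [norm_smul, Real.norm_of_nonneg hp]
    nlinarith [hm s]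
  have hGlim : ∀ s, Tendsto (fun m => G m s) atTop (𝓝 (Real.exp (κ - 1 / 2 * B (s - a)))) := by
    intro s
    have hl : Tendsto (fun m => Real.log (G m s)) atTop (𝓝 (κ - 1 / 2 * B (s - a))) := by
      rw [Metric.tendsto_nhds]
      intro η hη
      filter_upwards [hunif ‖s‖ η hη] with m hm using (hm s le_rfl).2
    refine (hl.rexp).congr' ?_
    filter_upwards [hunif ‖s‖ 1 one_pos] with m hm using Real.exp_log (hm s le_rfl).1
  have hl1 : ∀ s, Tendsto (fun m => G m s * w m s) atTop
      (𝓝 (Real.exp (κ - 1 / 2 * B (s - a)) * w₀)) := fun s => (hGlim s).mul (hwlim s)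
  have hl2 : ∀ s, Tendsto (fun m => (G m s * w m s) • s) atTop
      (𝓝 ((Real.exp (κ - 1 / 2 * B (s - a)) * w₀) • s)) := fun s => (hl1 s).smul_const s
  -- The pointwise limits inherit the dominating function, which yields integrability of the
  -- Gaussian without a separate computation.
  have hlim1 : ∀ s, ‖Real.exp (κ - 1 / 2 * B (s - a)) * w₀‖ ≤ bd s := fun s =>
    le_of_tendsto (hl1 s).norm (hb1.mono fun m hm => hm s)
  have hlim2 : ∀ s, ‖(Real.exp (κ - 1 / 2 * B (s - a)) * w₀) • s‖ ≤ bd s := fun s =>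
    le_of_tendsto (hl2 s).norm (hb2.mono fun m hm => hm s)
  have hi1 : Integrable (fun s => Real.exp (κ - 1 / 2 * B (s - a))) μ := by
    have : Integrable (fun s => Real.exp (κ - 1 / 2 * B (s - a)) * w₀) μ :=
      hbdi.mono' (by fun_prop) (ae_of_all _ hlim1)
    simpa [hw₀.ne'] using this.mul_const w₀⁻¹
  have hi2 : Integrable (fun s => Real.exp (κ - 1 / 2 * B (s - a)) • s) μ := by
    have : Integrable (fun s => (Real.exp (κ - 1 / 2 * B (s - a)) * w₀) • s) μ :=
      hbdi.mono' (by fun_prop) (ae_of_all _ hlim2)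
    have h := this.smul w₀⁻¹
    refine h.congr (ae_of_all _ fun s => ?_)
    simp only [Pi.smul_apply, smul_smul]
    congr 1
    field_simp
  refine ⟨?_, (∫ s, Real.exp (κ - 1 / 2 * B (s - a)) ∂μ) * w₀, mul_pos (integral_exp_pos hi1) hw₀,
    ?_, ?_⟩
  · filter_upwards [hb1, hb2] with m h1 h2
    exact ⟨hbdi.mono' (hm1 m) (ae_of_all _ h1), hbdi.mono' (hm2 m) (ae_of_all _ h2)⟩
  · rw [← integral_mul_const]
    exact tendsto_integral_filter_of_dominated_convergence bd (Eventually.of_forall hm1)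
      (hb1.mono fun m hm => ae_of_all _ hm) hbdi (ae_of_all _ hl1)
  · have hZ : ((∫ s, Real.exp (κ - 1 / 2 * B (s - a)) ∂μ) * w₀) • a =
        ∫ s, (Real.exp (κ - 1 / 2 * B (s - a)) * w₀) • s ∂μ := by
      simp_rw [mul_comm _ w₀, mul_smul]
      rw [integral_smul, integral_exp_even_smul μ hBeven a κ hi1 hi2]
    rw [hZ]
    exact tendsto_integral_filter_of_dominated_convergence bd (Eventually.of_forall hm2)
      (hb2.mono fun m hm => ae_of_all _ hm) hbdi (ae_of_all _ hl2)

end GaussianLimit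

/-! ### Positive definite quadratic forms -/

section QuadraticForm

variable {p : ℕ}

theorem dotProduct_mulVec_smul (J : Matrix (Fin p) (Fin p) ℝ) (t : ℝ)
    (s : EuclideanSpace ℝ (Fin p)) :
    (t • s).ofLp ⬝ᵥ (J *ᵥ (t • s).ofLp) = t ^ 2 * (s.ofLp ⬝ᵥ (J *ᵥ s.ofLp)) := by
  simp only [WithLp.ofLp_smul, Matrix.mulVec_smul, smul_dotProduct, dotProduct_smul, smul_eq_mul]
  ring

theorem continuous_dotProduct_mulVec (J : Matrix (Fin p) (Fin p) ℝ) :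
    Continuous fun s : EuclideanSpace ℝ (Fin p) => s.ofLp ⬝ᵥ (J *ᵥ s.ofLp) := by
  simp only [dotProduct, Matrix.mulVec]
  fun_prop

theorem _root_.Matrix.PosDef.exists_mul_norm_sq_le {J : Matrix (Fin p) (Fin p) ℝ}
    (hJ : J.PosDef) :
    ∃ c > 0, ∀ s : EuclideanSpace ℝ (Fin p), c * ‖s‖ ^ 2 ≤ s.ofLp ⬝ᵥ (J *ᵥ s.ofLp) := by
  have hpos : ∀ s : EuclideanSpace ℝ (Fin p), s ≠ 0 → 0 < s.ofLp ⬝ᵥ (J *ᵥ s.ofLp) := by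
    intro s hs
    have := hJ.dotProduct_mulVec_pos (x := s.ofLp) (by simpa using hs)
    simpa using this
  -- The unit sphere is empty exactly when p = 0; otherwise the constant is the minimum of the form
  -- on it.
  obtain hem | hne := (Metric.sphere (0 : EuclideanSpace ℝ (Fin p)) 1).eq_empty_or_nonempty
  · refine ⟨1, one_pos, fun s => ?_⟩
    have hs : s = 0 := by
      by_contra hs
      have : (‖s‖⁻¹ • s) ∈ Metric.sphere (0 : EuclideanSpace ℝ (Fin p)) 1 := by
        rw [mem_sphere_zero_iff_norm, norm_smul, norm_inv, norm_norm,
          inv_mul_cancel₀ (norm_ne_zero_iff.2 hs)]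
      rw [hem] at this
      exact this
    simp [hs]
  · obtain ⟨x, hx, hmin⟩ := (isCompact_sphere (0 : EuclideanSpace ℝ (Fin p)) 1).exists_isMinOn hne
      (continuous_dotProduct_mulVec J).continuousOn
    rw [mem_sphere_zero_iff_norm] at hx
    refine ⟨_, hpos x (norm_ne_zero_iff.1 (by rw [hx]; exact one_ne_zero)), fun s => ?_⟩
    by_cases hs : s = 0
    · simp [hs]
    have hs' := norm_ne_zero_iff.2 hs
    have h1 : (‖s‖⁻¹ • s) ∈ Metric.sphere (0 : EuclideanSpace ℝ (Fin p)) 1 := by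
      rw [mem_sphere_zero_iff_norm, norm_smul, norm_inv, norm_norm, inv_mul_cancel₀ hs']
    have h2 := hmin h1
    simp only [Set.mem_ofPred_eq] at h2
    rw [dotProduct_mulVec_smul] at h2
    have h3 := mul_le_mul_of_nonneg_right h2 (sq_nonneg ‖s‖)
    refine h3.trans_eq ?_
    field_simp

/-- The witnesses are a = J⁻¹u and κ = u'J⁻¹u/2. -/
theorem _root_.Matrix.PosDef.exists_complete_square {J : Matrix (Fin p) (Fin p) ℝ}
    (hJ : J.PosDef) (u : EuclideanSpace ℝ (Fin p)) :
    ∃ (a : EuclideanSpace ℝ (Fin p)) (κ : ℝ), ∀ s : EuclideanSpace ℝ (Fin p),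
      inner ℝ u s - 1 / 2 * (s.ofLp ⬝ᵥ (J *ᵥ s.ofLp)) =
        κ - 1 / 2 * ((s - a).ofLp ⬝ᵥ (J *ᵥ (s - a).ofLp)) := by
  have hdet : IsUnit J.det := (Matrix.isUnit_iff_isUnit_det J).1 hJ.isUnit
  set a : Fin p → ℝ := J⁻¹ *ᵥ u.ofLp with ha
  have hJa : J *ᵥ a = u.ofLp := by
    rw [ha, Matrix.mulVec_mulVec, Matrix.mul_nonsing_inv _ hdet, Matrix.one_mulVec]
  refine ⟨WithLp.toLp 2 a, 1 / 2 * (a ⬝ᵥ u.ofLp), fun s => ?_⟩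
  have hsymm : a ⬝ᵥ (J *ᵥ s.ofLp) = s.ofLp ⬝ᵥ u.ofLp := by
    have hT : Jᵀ = J := by simpa using hJ.isHermitian.eq
    rw [Matrix.dotProduct_mulVec, ← Matrix.mulVec_transpose, hT, hJa, dotProduct_comm]
  have hin : inner ℝ u s = s.ofLp ⬝ᵥ u.ofLp := by
    simp [EuclideanSpace.inner_eq_star_dotProduct]
  simp only [WithLp.ofLp_sub, Matrix.mulVec_sub, sub_dotProduct, dotProduct_sub, hJa, hsymm, hin]
  ring

end QuadraticForm

/-! ### Affine change of variables -/

section LocalParameter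

theorem quasiMeasurePreserving_add_smul {E : Type*} [NormedAddCommGroup E] [NormedSpace ℝ E]
    [FiniteDimensional ℝ E] [MeasurableSpace E] [BorelSpace E] (μ : Measure E)
    [μ.IsAddHaarMeasure] (x : E) {r : ℝ} (hr : r ≠ 0) :
    Measure.QuasiMeasurePreserving (fun s => x + r • s) μ μ := by
  refine (measurePreserving_add_left μ x).quasiMeasurePreserving.comp (g := fun s => x + s)
    (f := fun s => r • s) ⟨measurable_const_smul r, ?_⟩
  rw [Measure.map_addHaar_smul μ hr]
  exact Measure.smul_absolutelyContinuous

variable {E V : Type*} [NormedAddCommGroup E] [NormedSpace ℝ E] [FiniteDimensional ℝ E]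
  [MeasurableSpace E] [BorelSpace E] [NormedAddCommGroup V]

theorem integrable_comp_add_smul_iff (μ : Measure E) [μ.IsAddHaarMeasure] (g : E → V) (x : E)
    {r : ℝ} (hr : r ≠ 0) : Integrable (fun s => g (x + r • s)) μ ↔ Integrable g μ := by
  rw [integrable_comp_smul_iff μ (fun s => g (x + s)) hr]
  exact ⟨fun h => by simpa using h.comp_add_left (-x), fun h => h.comp_add_left x⟩

theorem integral_comp_add_smul [NormedSpace ℝ V] (μ : Measure E) [μ.IsAddHaarMeasure] (g : E → V)
    (x : E) (r : ℝ) :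
    ∫ s, g (x + r • s) ∂μ = |(r ^ Module.finrank ℝ E)⁻¹| • ∫ s, g s ∂μ := by
  rw [Measure.integral_comp_smul μ (fun s => g (x + s)) r, integral_add_left_eq_self]

end LocalParameter

/-- The likelihood ratio `L_n(θ₀ + r s) / L_n(θ₀)` in the local parameter `s`, zero outside the
parameter space. -/
noncomputable def localLikelihood {𝒴 E : Type*} [AddCommGroup E] [Module ℝ E] (Θ : Set E)
    (f : 𝒴 → E → ℝ) (θ₀ : E) (r : ℝ) (n : ℕ) (y : ℕ → 𝒴) (s : E) : ℝ :=
  (likelihood f n y θ₀)⁻¹ * Θ.indicator (likelihood f n y) (θ₀ + r • s)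

/-! ### The likelihood ratio in the local parameter -/

section LocalLikelihood

theorem likelihood_nonneg {𝒴 E : Type*} {Θ : Set E} {f : 𝒴 → E → ℝ}
    (hf : ∀ y, ∀ θ ∈ Θ, 0 ≤ f y θ) (n : ℕ) (y : ℕ → 𝒴) :
    ∀ θ ∈ Θ, 0 ≤ likelihood f n y θ :=
  fun θ hθ => Finset.prod_nonneg fun i _ => hf (y i) θ hθ

variable {𝒴 E : Type*} [AddCommGroup E] [Module ℝ E] {Θ : Set E}
  {f : 𝒴 → E → ℝ} {θ₀ : E} {r : ℝ} {n : ℕ} {y : ℕ → 𝒴}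

theorem localLikelihood_zero (hθ₀ : θ₀ ∈ Θ) (hL : 0 < likelihood f n y θ₀) :
    localLikelihood Θ f θ₀ r n y 0 = 1 := by
  rw [localLikelihood, smul_zero, add_zero, Set.indicator_of_mem hθ₀, inv_mul_cancel₀ hL.ne']

theorem localLikelihood_nonneg (hf : ∀ y, ∀ θ ∈ Θ, 0 ≤ f y θ) (hL : 0 < likelihood f n y θ₀)
    (s : E) : 0 ≤ localLikelihood Θ f θ₀ r n y s :=
  mul_nonneg (inv_nonneg.2 hL.le) (Set.indicator_nonneg (likelihood_nonneg hf n y) _)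

theorem logConcaveOn_localLikelihood (hΘ : Convex ℝ Θ) (hf : ∀ y, ∀ θ ∈ Θ, 0 ≤ f y θ)
    (hconc : ∀ y, LogConcaveOn Θ (f y)) (hL : 0 < likelihood f n y θ₀) :
    LogConcaveOn Set.univ (localLikelihood Θ f θ₀ r n y) := by
  have h1 : LogConcaveOn Θ (likelihood f n y) :=
    LogConcaveOn.prod _ (fun i _ => hf (y i)) fun i _ => hconc (y i)
  exact (h1.indicator hΘ (likelihood_nonneg hf n y)).const_mul_comp_affine
    (Set.indicator_nonneg (likelihood_nonneg hf n y)) (inv_pos.2 hL) θ₀ r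

theorem log_localLikelihood {s : E} (hs : θ₀ + r • s ∈ Θ) (hL : 0 < likelihood f n y θ₀)
    (hLs : 0 < likelihood f n y (θ₀ + r • s)) :
    0 < localLikelihood Θ f θ₀ r n y s ∧ Real.log (localLikelihood Θ f θ₀ r n y s) =
      Real.log (likelihood f n y (θ₀ + r • s)) - Real.log (likelihood f n y θ₀) := by
  rw [localLikelihood, Set.indicator_of_mem hs]
  refine ⟨mul_pos (inv_pos.2 hL) hLs, ?_⟩
  rw [Real.log_mul (inv_pos.2 hL).ne' hLs.ne', Real.log_inv]
  ring

theorem IsMLE.localLikelihood_le (hf : ∀ y, ∀ θ ∈ Θ, 0 ≤ f y θ) (hL : 0 < likelihood f n y θ₀)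
    (hr : r ≠ 0) {x : E} (hx : IsMLE Θ f n y x) (t : E) :
    localLikelihood Θ f θ₀ r n y t ≤ localLikelihood Θ f θ₀ r n y (r⁻¹ • (x - θ₀)) := by
  refine mul_le_mul_of_nonneg_left ?_ (inv_nonneg.2 hL.le)
  rw [smul_inv_smul₀ hr, add_sub_cancel, Set.indicator_of_mem hx.1]
  exact Set.indicator_le' (s := Θ) (f := likelihood f n y)
    (g := fun _ => likelihood f n y x) hx.2
    (fun _ _ => likelihood_nonneg hf n y x hx.1) _

/-- A global maximiser has value at least 1, the value at the origin, so it cannot lie where the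
extension by zero lives. -/
theorem isMLE_of_localLikelihood_le (hθ₀ : θ₀ ∈ Θ) (hL : 0 < likelihood f n y θ₀) (hr : r ≠ 0)
    {s : E} (hs : ∀ t, localLikelihood Θ f θ₀ r n y t ≤ localLikelihood Θ f θ₀ r n y s) :
    IsMLE Θ f n y (θ₀ + r • s) := by
  have h0 : 0 < localLikelihood Θ f θ₀ r n y s :=
    zero_lt_one.trans_le ((localLikelihood_zero hθ₀ hL).ge.trans (hs 0))
  have hmem : θ₀ + r • s ∈ Θ := by
    by_contra h
    rw [localLikelihood, Set.indicator_of_notMem h, mul_zero] at h0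
    exact lt_irrefl _ h0
  refine ⟨hmem, fun θ hθ => ?_⟩
  have h := le_of_mul_le_mul_left (hs (r⁻¹ • (θ - θ₀))) (inv_pos.2 hL)
  rwa [smul_inv_smul₀ hr, add_sub_cancel, Set.indicator_of_mem hθ,
    Set.indicator_of_mem hmem] at h

end LocalLikelihood

/-! ### The posterior in the local parameter -/

section Posterior

variable {𝒴 : Type*} {p : ℕ} {Θ : Set (EuclideanSpace ℝ (Fin p))}
  {f : 𝒴 → EuclideanSpace ℝ (Fin p) → ℝ} {θ₀ : EuclideanSpace ℝ (Fin p)}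
  {prior : EuclideanSpace ℝ (Fin p) → ℝ} {r : ℝ} {n : ℕ} {y : ℕ → 𝒴}

/-- The posterior in terms of the local parameter. -/
theorem posterior_of_local (hΘ : IsOpen Θ) (hL : 0 < likelihood f n y θ₀) (hr : 0 < r)
    (h1 : Integrable fun s => localLikelihood Θ f θ₀ r n y s * Θ.indicator prior (θ₀ + r • s))
    (h2 : Integrable fun s =>
      (localLikelihood Θ f θ₀ r n y s * Θ.indicator prior (θ₀ + r • s)) • s)
    (hpos : 0 < ∫ s, localLikelihood Θ f θ₀ r n y s * Θ.indicator prior (θ₀ + r • s)) :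
    PosteriorMeanExists Θ f prior n y ∧
      posteriorMean Θ f prior n y = θ₀ + r •
        ((∫ s, localLikelihood Θ f θ₀ r n y s * Θ.indicator prior (θ₀ + r • s))⁻¹ •
          ∫ s, (localLikelihood Θ f θ₀ r n y s * Θ.indicator prior (θ₀ + r • s)) • s) := by
  set g : EuclideanSpace ℝ (Fin p) → ℝ := fun s =>
    localLikelihood Θ f θ₀ r n y s * Θ.indicator prior (θ₀ + r • s) with hg
  set L := likelihood f n y θ₀ with hLdef
  have hk1 : ∀ s, Θ.indicator (posteriorKernel f prior n y) (θ₀ + r • s) = L * g s := by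
    intro s
    by_cases hs : θ₀ + r • s ∈ Θ
    · simp only [hg, localLikelihood, Set.indicator_of_mem hs, posteriorKernel, ← hLdef]
      field_simp
    · simp [hg, Set.indicator_of_notMem hs]
  have hk2 : ∀ s, Θ.indicator (fun θ => posteriorKernel f prior n y θ • θ) (θ₀ + r • s) =
      (L * g s) • θ₀ + (L * r) • (g s • s) := by
    intro s
    rw [Set.indicator_smul_left]
    change Θ.indicator (posteriorKernel f prior n y) (θ₀ + r • s) • (θ₀ + r • s) = _
    rw [hk1, smul_add, smul_smul, smul_smul]
    congr 2
    ring
  have h2' : Integrable fun s => (L * r) • (g s • s) := h2.smul (L * r)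
  have hi1 : IntegrableOn (posteriorKernel f prior n y) Θ := by
    rw [← integrable_indicator_iff hΘ.measurableSet,
      ← integrable_comp_add_smul_iff volume _ θ₀ hr.ne']
    simp only [hk1]
    exact h1.const_mul L
  have hi2 : IntegrableOn (fun θ => posteriorKernel f prior n y θ • θ) Θ := by
    rw [← integrable_indicator_iff hΘ.measurableSet,
      ← integrable_comp_add_smul_iff volume _ θ₀ hr.ne']
    simp only [hk2]
    exact ((h1.const_mul L).smul_const θ₀).add h2'
  -- The Jacobian of the substitution; it cancels in the quotient, as does `L`.
  set c := |(r ^ Module.finrank ℝ (EuclideanSpace ℝ (Fin p)))⁻¹| with hc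
  have hcpos : 0 < c := by positivity
  have e1 : L * ∫ s, g s = c * ∫ θ in Θ, posteriorKernel f prior n y θ := by
    rw [← integral_indicator hΘ.measurableSet, ← smul_eq_mul c,
      ← integral_comp_add_smul volume _ θ₀ r]
    simp only [hk1]
    rw [integral_const_mul]
  have e2 : (L * ∫ s, g s) • θ₀ + (L * r) • ∫ s, g s • s =
      c • ∫ θ in Θ, posteriorKernel f prior n y θ • θ := by
    rw [← integral_indicator hΘ.measurableSet, ← integral_comp_add_smul volume _ θ₀ r]
    simp only [hk2]
    rw [integral_add ((h1.const_mul L).smul_const θ₀) h2', integral_smul_const,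
      integral_const_mul, integral_smul]
  have hI : 0 < ∫ θ in Θ, posteriorKernel f prior n y θ :=
    pos_of_mul_pos_right (e1 ▸ mul_pos hL hpos) hcpos.le
  refine ⟨⟨hi1, hI, hi2⟩, ?_⟩
  rw [posteriorMean]
  have e3 : (∫ θ in Θ, posteriorKernel f prior n y θ) = c⁻¹ * (L * ∫ s, g s) := by
    rw [e1, inv_mul_cancel_left₀ hcpos.ne']
  have e4 : (∫ θ in Θ, posteriorKernel f prior n y θ • θ) =
      c⁻¹ • ((L * ∫ s, g s) • θ₀ + (L * r) • ∫ s, g s • s) := by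
    rw [e2, inv_smul_smul₀ hcpos.ne']
  rw [e3, e4]
  have hne := hpos.ne'
  simp only [smul_add, smul_smul]
  congr 1
  · convert one_smul ℝ θ₀ using 2
    field_simp
  · congr 1
    field_simp

end Posterior

/-- A maximum likelihood estimate and the posterior mean exist, and `√n` times their distance is
less than `ε`. -/
def CloseEstimates {𝒴 : Type*} {p : ℕ} (Θ : Set (EuclideanSpace ℝ (Fin p)))
    (f : 𝒴 → EuclideanSpace ℝ (Fin p) → ℝ) (prior : EuclideanSpace ℝ (Fin p) → ℝ)
    (ε : ℝ) (n : ℕ) (y : ℕ → 𝒴) : Prop :=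
  (∃ θ, IsMLE Θ f n y θ) ∧ PosteriorMeanExists Θ f prior n y ∧
    ∀ x, IsMLE Θ f n y x → ‖√(n : ℝ) • (posteriorMean Θ f prior n y - x)‖ < ε

/-- The difference between the log-likelihood ratio in the local parameter `s` and its quadratic
approximation with linear term `u`. -/
noncomputable def quadraticError {𝒴 : Type*} {p : ℕ} (f : 𝒴 → EuclideanSpace ℝ (Fin p) → ℝ)
    (θ₀ : EuclideanSpace ℝ (Fin p)) (J : Matrix (Fin p) (Fin p) ℝ) (n : ℕ) (y : ℕ → 𝒴)
    (u s : EuclideanSpace ℝ (Fin p)) : ℝ :=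
  Real.log (likelihood f n y (θ₀ + (√(n : ℝ))⁻¹ • s)) - Real.log (likelihood f n y θ₀) -
    (inner ℝ u s - 1 / 2 * (s.ofLp ⬝ᵥ (J *ᵥ s.ofLp)))

/-! ### Deterministic limit theorem and its finite form -/

section Deterministic

variable {𝒴 : Type*} {p : ℕ} {Θ : Set (EuclideanSpace ℝ (Fin p))} (hΘopen : IsOpen Θ)
  (hΘconv : Convex ℝ Θ) {f : 𝒴 → EuclideanSpace ℝ (Fin p) → ℝ}
  (hfnn : ∀ y, ∀ θ ∈ Θ, 0 ≤ f y θ) (hfconc : ∀ y, LogConcaveOn Θ (f y))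
  {θ₀ : EuclideanSpace ℝ (Fin p)} (hθ₀ : θ₀ ∈ Θ)
  {J : Matrix (Fin p) (Fin p) ℝ} (hJ : J.PosDef)
  {prior : EuclideanSpace ℝ (Fin p) → ℝ}
  (hpmeas : AEMeasurable prior (volume.restrict Θ))
  (hpnonneg : ∀ θ ∈ Θ, 0 ≤ prior θ)
  (hpcont : ContinuousAt prior θ₀) (hppos : 0 < prior θ₀)
  {C₁ C₂ : ℝ} (hC₁ : 0 < C₁) (hC₂ : 0 < C₂)
  (hpgrowth : ∀ θ ∈ Θ, prior θ ≤ C₁ * Real.exp (C₂ * ‖θ‖))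
  {q : ℕ → EuclideanSpace ℝ (Fin p)} (hq : DenseRange q)
  (hqT : ∀ R : ℝ, ∃ T : Finset (EuclideanSpace ℝ (Fin p)),
    (T : Set (EuclideanSpace ℝ (Fin p))) ⊆ Set.range q ∧
      Metric.closedBall 0 R ⊆ convexHull ℝ (T : Set (EuclideanSpace ℝ (Fin p))))

include hΘopen hΘconv hfnn hfconc hθ₀ hJ hpmeas hpnonneg hpcont hppos hC₁ hC₂ hpgrowth hq hqT

/-- With the data replaced by a deterministic array and u convergent, the local likelihoods have a
fixed quadratic limit, so the Gaussian-limit results apply directly. -/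
theorem eventually_closeEstimates {N : ℕ → ℕ} (hN : Tendsto N atTop atTop) (hN0 : ∀ m, 0 < N m)
    {y : ℕ → ℕ → 𝒴} {u : ℕ → EuclideanSpace ℝ (Fin p)} {u₀ : EuclideanSpace ℝ (Fin p)}
    (hu : Tendsto u atTop (𝓝 u₀)) (hL : ∀ m, 0 < likelihood f (N m) (y m) θ₀)
    (hLq : ∀ j, ∀ᶠ m in atTop, 0 < likelihood f (N m) (y m) (θ₀ + (√(N m : ℝ))⁻¹ • q j))
    (hlim : ∀ j, Tendsto (fun m => quadraticError f θ₀ J (N m) (y m) (u m) (q j)) atTop (𝓝 0))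
    {ε : ℝ} (hε : 0 < ε) :
    ∀ᶠ m in atTop, CloseEstimates Θ f prior ε (N m) (y m) := by
  set r : ℕ → ℝ := fun m => (√(N m : ℝ))⁻¹ with hr
  have hrpos : ∀ m, 0 < r m := fun m => inv_pos.2 (Real.sqrt_pos.2 (Nat.cast_pos.2 (hN0 m)))
  have hr0 : Tendsto r atTop (𝓝 0) :=
    (tendsto_inv_atTop_zero.comp (Real.tendsto_sqrt_atTop.comp
      (tendsto_natCast_atTop_atTop.comp hN)))
  have hθlim : ∀ s : EuclideanSpace ℝ (Fin p), Tendsto (fun m => θ₀ + r m • s) atTop (𝓝 θ₀) := by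
    intro s
    simpa using (hr0.smul_const s).const_add θ₀
  have hθmem : ∀ s : EuclideanSpace ℝ (Fin p), ∀ᶠ m in atTop, θ₀ + r m • s ∈ Θ := fun s =>
    (hθlim s).eventually (hΘopen.mem_nhds hθ₀)
  obtain ⟨c, hc, hB⟩ := hJ.exists_mul_norm_sq_le
  obtain ⟨a, κ, hsq⟩ := hJ.exists_complete_square u₀
  set B : EuclideanSpace ℝ (Fin p) → ℝ := fun s => s.ofLp ⬝ᵥ (J *ᵥ s.ofLp) with hBdef
  have hBc : Continuous B := continuous_dotProduct_mulVec J
  have hBeven : ∀ s, B (-s) = B s := fun s => by simp [hBdef, Matrix.mulVec_neg]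
  have hB0 : B 0 = 0 := by simp [hBdef]
  set G : ℕ → EuclideanSpace ℝ (Fin p) → ℝ := fun m =>
    localLikelihood Θ f θ₀ (r m) (N m) (y m) with hG
  have hconc : ∀ m, LogConcaveOn Set.univ (G m) := fun m =>
    logConcaveOn_localLikelihood hΘconv hfnn hfconc (hL m)
  have hGnn : ∀ m s, 0 ≤ G m s := fun m => localLikelihood_nonneg hfnn (hL m)
  have hG0 : ∀ m, G m 0 = 1 := fun m => localLikelihood_zero hθ₀ (hL m)
  have hGq : ∀ j, ∀ᶠ m in atTop, 0 < G m (q j) ∧ Real.log (G m (q j)) =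
      Real.log (likelihood f (N m) (y m) (θ₀ + r m • q j)) -
        Real.log (likelihood f (N m) (y m) θ₀) := by
    intro j
    filter_upwards [hθmem (q j), hLq j] with m h1 h2
    exact log_localLikelihood h1 (hL m) h2
  have hunif := eventually_abs_log_sub_lt hconc hG0
    (φ := fun s => κ - 1 / 2 * B (s - a)) (by fun_prop) hq hqT
    (fun j => (hGq j).mono fun m hm => hm.1) (fun j => by
      have h1 : Tendsto (fun m => quadraticError f θ₀ J (N m) (y m) (u m) (q j) +
          (inner ℝ (u m) (q j) - 1 / 2 * B (q j))) atTop
          (𝓝 (0 + (inner ℝ u₀ (q j) - 1 / 2 * B (q j)))) :=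
        (hlim j).add ((hu.inner tendsto_const_nhds).sub tendsto_const_nhds)
      rw [zero_add, hsq] at h1
      refine h1.congr' ?_
      filter_upwards [hGq j] with m hm
      rw [hm.2, quadraticError]
      ring)
  have hunif' : ∀ R η : ℝ, 0 < η → ∀ᶠ m in atTop, ∀ s, ‖s‖ ≤ R →
      0 < G m s ∧ |Real.log (G m s) - (κ - 1 / 2 * B (s - a))| < η := fun R η hη => hunif R hη
  set w : ℕ → EuclideanSpace ℝ (Fin p) → ℝ := fun m s => Θ.indicator prior (θ₀ + r m • s) with hw
  have hpm : AEStronglyMeasurable (Θ.indicator prior) volume :=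
    (aestronglyMeasurable_indicator_iff hΘopen.measurableSet).2 hpmeas.aestronglyMeasurable
  have hwm : ∀ m, AEStronglyMeasurable (w m) volume := fun m =>
    hpm.comp_quasiMeasurePreserving (quasiMeasurePreserving_add_smul volume θ₀ (hrpos m).ne')
  have hwnn : ∀ m s, 0 ≤ w m s := fun m s => Set.indicator_nonneg hpnonneg _
  have hwC : ∀ m s, w m s ≤ C₁ * Real.exp (C₂ * ‖θ₀‖) * Real.exp (C₂ * r m * ‖s‖) := by
    intro m s
    by_cases hs : θ₀ + r m • s ∈ Θ
    · simp only [hw, Set.indicator_of_mem hs]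
      refine (hpgrowth _ hs).trans ?_
      rw [mul_assoc, ← Real.exp_add]
      have h1 : ‖θ₀ + r m • s‖ ≤ ‖θ₀‖ + r m * ‖s‖ := by
        refine (norm_add_le _ _).trans ?_
        rw [norm_smul, Real.norm_of_nonneg (hrpos m).le]
      have h2 := mul_le_mul_of_nonneg_left h1 hC₂.le
      refine mul_le_mul_of_nonneg_left (Real.exp_le_exp.2 ?_) hC₁.le
      linarith
    · simp only [hw, Set.indicator_of_notMem hs]
      positivity
  have hwlim : ∀ s, Tendsto (fun m => w m s) atTop (𝓝 (prior θ₀)) := by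
    intro s
    refine (hpcont.tendsto.comp (hθlim s)).congr' ?_
    filter_upwards [hθmem s] with m hm
    simp only [hw, Set.indicator_of_mem hm, Function.comp]
  obtain ⟨hint, Z, hZ, hZ1, hZ2⟩ := tendsto_integral_and_moment volume hconc hGnn hG0 hBc hBeven hc
    hB hunif' hwm hwnn (by simpa using hr0.const_mul C₂) hwC hppos hwlim
  have hmean : Tendsto (fun m => (∫ s, G m s * w m s)⁻¹ • ∫ s, (G m s * w m s) • s) atTop
      (𝓝 a) := by
    have := (hZ1.inv₀ hZ.ne').smul hZ2
    rwa [inv_smul_smul₀ hZ.ne'] at this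
  filter_upwards [hint, hZ1.eventually (lt_mem_nhds hZ),
    eventually_maximiser_near hconc hB0 hc hB hunif' (half_pos hε),
    Metric.tendsto_nhds.1 hmean (ε / 2) (half_pos hε)] with m hi hZm hmax hme
  obtain ⟨hpe, hpm⟩ := posterior_of_local hΘopen (hL m) (hrpos m) hi.1 hi.2 hZm
  refine ⟨?_, hpe, fun x hx => ?_⟩
  · obtain ⟨s, hs⟩ := hmax.1
    exact ⟨_, isMLE_of_localLikelihood_le hθ₀ (hL m) (hrpos m).ne' hs⟩
  · have h1 := hmax.2 _ (hx.localLikelihood_le hfnn (hL m) (hrpos m).ne')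
    have h2 : √(N m : ℝ) = (r m)⁻¹ := by rw [hr, inv_inv]
    rw [dist_eq_norm] at hme
    -- Both estimates are compared with the centre `a` in the local scale, each within ε/2.
    have h3 : √(N m : ℝ) • (posteriorMean Θ f prior (N m) (y m) - x) =
        ((∫ s, G m s * w m s)⁻¹ • (∫ s, (G m s * w m s) • s) - a) -
          ((r m)⁻¹ • (x - θ₀) - a) := by
      rw [hpm, h2]
      have h4 : ∀ v : EuclideanSpace ℝ (Fin p), θ₀ + r m • v - x =
        r m • (v - (r m)⁻¹ • (x - θ₀)) := fun v => by
          rw [smul_sub, smul_inv_smul₀ (hrpos m).ne']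
          abel
      rw [h4, inv_smul_smul₀ (hrpos m).ne', sub_sub_sub_cancel_right]
    rw [h3]
    refine (norm_sub_le _ _).trans_lt ?_
    linarith

/-- The estimates are close as soon as the quadratic approximation is good at finitely many
points. -/
theorem exists_closeEstimates_of_quadraticError (K : ℝ) {ε : ℝ} (hε : 0 < ε) :
    ∃ N : ℕ, ∀ n, N < n → ∀ (y : ℕ → 𝒴) (u : EuclideanSpace ℝ (Fin p)), ‖u‖ ≤ K →
      0 < likelihood f n y θ₀ →
      (∀ j < N, 0 < likelihood f n y (θ₀ + (√(n : ℝ))⁻¹ • q j)) →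
      (∀ j < N, |quadraticError f θ₀ J n y u (q j)| < ((N : ℝ) + 1)⁻¹) →
      CloseEstimates Θ f prior ε n y := by
  -- `N` is at once a bound on n, the number of test points and the inverse tolerance.
  -- Counterexamples for every `N` thus form a sequence along which the approximation holds at each
  -- `q j`; boundedness gives a subsequence with u convergent.
  by_contra! hcon
  choose n hn y u hu hL hLq herr hbad using hcon
  obtain ⟨u₀, -, φ, hφ, hlim⟩ := tendsto_subseq_of_bounded
    (Metric.isBounded_closedBall (x := (0 : EuclideanSpace ℝ (Fin p))) (r := K))
    (fun m => mem_closedBall_zero_iff.2 (hu m))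
  have hφt := hφ.tendsto_atTop
  have hnt : Tendsto n atTop atTop := tendsto_atTop_mono (fun m => (hn m).le) tendsto_id
  have hev := eventually_closeEstimates hΘopen hΘconv hfnn hfconc hθ₀ hJ hpmeas hpnonneg hpcont
    hppos hC₁ hC₂ hpgrowth hq hqT (N := fun m => n (φ m)) (hnt.comp hφt)
    (fun m => (Nat.zero_le _).trans_lt (hn (φ m)))
    (y := fun m => y (φ m)) hlim (fun m => hL (φ m)) (fun j => ?_) (fun j => ?_) hε
  · obtain ⟨m, hm⟩ := hev.exists
    exact hbad (φ m) hm
  · filter_upwards [hφt.eventually (eventually_gt_atTop j)] with m hm using hLq (φ m) j hm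
  · have h1 : Tendsto (fun m => ((φ m : ℝ) + 1)⁻¹) atTop (𝓝 0) :=
      tendsto_inv_atTop_zero.comp
        (tendsto_atTop_add_const_right _ _ (tendsto_natCast_atTop_atTop.comp hφt))
    refine squeeze_zero_norm' ?_ h1
    filter_upwards [hφt.eventually (eventually_gt_atTop j)] with m hm
    exact (herr (φ m) j hm).le

end Deterministic

/-- With u the normalised score the linear terms cancel exactly. -/
theorem quadraticError_eq_sum_remainder {𝒴 : Type*} {p : ℕ}
    {f : 𝒴 → EuclideanSpace ℝ (Fin p) → ℝ} {θ₀ : EuclideanSpace ℝ (Fin p)}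
    {D : 𝒴 → EuclideanSpace ℝ (Fin p)} {J : Matrix (Fin p) (Fin p) ℝ}
    {n : ℕ} {y : ℕ → 𝒴} {s : EuclideanSpace ℝ (Fin p)}
    (h0 : ∀ i, 0 < f (y i) θ₀) (hs : ∀ i, 0 < f (y i) (θ₀ + (√(n : ℝ))⁻¹ • s)) :
    quadraticError f θ₀ J n y ((√(n : ℝ))⁻¹ • ∑ i ∈ Finset.range n, D (y i)) s =
      ∑ i ∈ Finset.range n, remainder f θ₀ D (y i) ((√(n : ℝ))⁻¹ • s) +
        1 / 2 * (s.ofLp ⬝ᵥ (J *ᵥ s.ofLp)) := by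
  rw [quadraticError, likelihood, likelihood, Real.log_prod fun i _ => (h0 i).ne',
    Real.log_prod fun i _ => (hs i).ne']
  simp only [remainder, Finset.sum_sub_distrib, real_inner_smul_left, real_inner_smul_right,
    sum_inner, Finset.mul_sum]
  ring

/-! ### Chebyshev bounds for scores and remainders -/

section Probability

variable {Ω 𝒴 : Type*} [MeasurableSpace Ω] [MeasurableSpace 𝒴] {P : Measure Ω}
  {F : Measure 𝒴} {Y : ℕ → Ω → 𝒴}

theorem ae_forall_comp (hYmeas : ∀ i, Measurable (Y i)) (hYlaw : ∀ i, P.map (Y i) = F)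
    {Q : 𝒴 → Prop} (hQ : ∀ᵐ y ∂F, Q y) : ∀ᵐ ω ∂P, ∀ i, Q (Y i ω) :=
  ae_all_iff.2 fun i => ae_of_ae_map (hYmeas i).aemeasurable ((hYlaw i).symm ▸ hQ)

variable [IsProbabilityMeasure P]

/-- Chebyshev's inequality for sums of independent identically distributed variables. -/
theorem measure_abs_sum_sub_ge_le (hYmeas : ∀ i, Measurable (Y i)) (hYlaw : ∀ i, P.map (Y i) = F)
    (hYindep : iIndepFun Y P) {h : 𝒴 → ℝ} (hh : MemLp h 2 F) (n : ℕ) {δ : ℝ} (hδ : 0 < δ) :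
    P {ω | δ ≤ |∑ i ∈ Finset.range n, h (Y i ω) - n * ∫ y, h y ∂F|} ≤
      ENNReal.ofReal (n * variance h F / δ ^ 2) := by
  have hh' : ∀ i, MemLp h 2 (P.map (Y i)) := fun i => (hYlaw i).symm ▸ hh
  have hmem : ∀ i, MemLp (fun ω => h (Y i ω)) 2 P := fun i =>
    (hh' i).comp_of_map (hYmeas i).aemeasurable
  have hind : iIndepFun (fun i => h ∘ Y i) P :=
    hYindep.comp₀ (fun _ => h) (fun i => (hYmeas i).aemeasurable) fun i => (hh' i).1.aemeasurable
  have hint : ∀ i, ∫ ω, h (Y i ω) ∂P = ∫ y, h y ∂F := fun i => by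
    rw [← hYlaw i, integral_map (hYmeas i).aemeasurable (hh' i).1]
  have hvar : ∀ i, variance (fun ω => h (Y i ω)) P = variance h F := fun i => by
    rw [← hYlaw i, variance_map (hh' i).1.aemeasurable (hYmeas i).aemeasurable]
    rfl
  have hsum : MemLp (∑ i ∈ Finset.range n, fun ω => h (Y i ω)) 2 P :=
    memLp_finsetSum' _ fun i _ => hmem i
  have hV : variance (∑ i ∈ Finset.range n, fun ω => h (Y i ω)) P = n * variance h F := by
    rw [IndepFun.variance_sum (fun i _ => hmem i) fun i _ j _ hij => hind.indepFun hij]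
    simp [hvar]
  have hE : ∫ ω, (∑ i ∈ Finset.range n, fun ω => h (Y i ω)) ω ∂P = n * ∫ y, h y ∂F := by
    simp only [Finset.sum_apply]
    rw [integral_finsetSum _ fun i _ => (hmem i).integrable one_le_two]
    simp [hint]
  have := meas_ge_le_variance_div_sq hsum hδ
  rw [hV, hE] at this
  simpa only [Finset.sum_apply] using this

variable {p : ℕ}

theorem tendsto_inv_sqrt_smul (s : EuclideanSpace ℝ (Fin p)) :
    Tendsto (fun n : ℕ => (√(n : ℝ))⁻¹ • s) atTop (𝓝 0) := by
  have h : Tendsto (fun n : ℕ => (√(n : ℝ))⁻¹) atTop (𝓝 0) :=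
    tendsto_inv_atTop_zero.comp (Real.tendsto_sqrt_atTop.comp tendsto_natCast_atTop_atTop)
  simpa using h.smul_const s

/-- The scaling n‖s/√n‖² = ‖s‖² is constant in n, so o(‖t‖²) becomes o(1/n). -/
theorem tendsto_natCast_mul_of_isLittleO {g : EuclideanSpace ℝ (Fin p) → ℝ}
    (hg : g =o[𝓝 0] fun t => ‖t‖ ^ 2) (s : EuclideanSpace ℝ (Fin p)) :
    Tendsto (fun n : ℕ => n * g ((√(n : ℝ))⁻¹ • s)) atTop (𝓝 0) := by
  have h1 := hg.comp_tendsto (tendsto_inv_sqrt_smul s)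
  have h2 := (isBigO_refl (fun n : ℕ => (n : ℝ)) atTop).mul_isLittleO h1
  refine (isLittleO_one_iff ℝ).1 (h2.trans_isBigO (IsBigO.of_bound (‖s‖ ^ 2)
    ((eventually_gt_atTop 0).mono fun n hn => ?_)))
  have hn' : (n : ℝ) ≠ 0 := Nat.cast_ne_zero.2 hn.ne'
  rw [Function.comp, norm_smul, norm_inv, Real.norm_of_nonneg (Real.sqrt_nonneg _), mul_pow,
    inv_pow, Real.sq_sqrt (Nat.cast_nonneg n), mul_inv_cancel_left₀ hn', norm_one, mul_one,
    Real.norm_of_nonneg (sq_nonneg _)]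

/-- The normalised sum of the scores is bounded in probability. -/
theorem exists_measure_norm_score_gt_le [IsProbabilityMeasure F]
    (hYmeas : ∀ i, Measurable (Y i)) (hYlaw : ∀ i, P.map (Y i) = F)
    (hYindep : iIndepFun Y P) {D : 𝒴 → EuclideanSpace ℝ (Fin p)} (hD : MemLp D 2 F)
    (hD0 : ∫ y, D y ∂F = 0) {η : ℝ≥0∞} (hη : 0 < η) :
    ∃ K : ℝ, ∀ n : ℕ, 0 < n →
      P {ω | K < ‖(√(n : ℝ))⁻¹ • ∑ i ∈ Finset.range n, D (Y i ω)‖} ≤ η := by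
  have hDk : ∀ k, MemLp (fun y => D y k) 2 F := fun k =>
    hD.continuousLinearMap_comp (EuclideanSpace.proj k : EuclideanSpace ℝ (Fin p) →L[ℝ] ℝ)
  have hDk0 : ∀ k, ∫ y, D y k ∂F = 0 := fun k => by
    have := (EuclideanSpace.proj k : EuclideanSpace ℝ (Fin p) →L[ℝ] ℝ).integral_comp_comm
      (hD.integrable one_le_two)
    rw [hD0] at this
    simpa using this
  set V : ℝ := ∑ k, variance (fun y => D y k) F with hV
  have hlim : Tendsto (fun x : ℝ => ENNReal.ofReal (V / x ^ 2)) atTop (𝓝 0) := by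
    rw [← ENNReal.ofReal_zero]
    exact ENNReal.tendsto_ofReal ((tendsto_pow_atTop two_ne_zero).const_div_atTop V)
  obtain ⟨x, hx, hx0⟩ := ((hlim.eventually (ge_mem_nhds hη)).and (eventually_gt_atTop 0)).exists
  -- If all p coordinates are below x in absolute value, the norm is at most √(p x²); a union bound
  -- over coordinates follows.
  refine ⟨√(p * x ^ 2), fun n hn => ?_⟩
  have hn' : (0 : ℝ) < n := Nat.cast_pos.2 hn
  have hsq := Real.sqrt_pos.2 hn'
  have hsub : {ω | √(p * x ^ 2) < ‖(√(n : ℝ))⁻¹ • ∑ i ∈ Finset.range n, D (Y i ω)‖} ⊆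
      ⋃ k ∈ (Finset.univ : Finset (Fin p)), {ω | √(n : ℝ) * x ≤
        |∑ i ∈ Finset.range n, D (Y i ω) k - n * ∫ y, D y k ∂F|} := by
    intro ω hω
    by_contra hcon
    simp only [Finset.mem_univ, Set.iUnion_true, Set.mem_iUnion, Set.mem_ofPred_eq, not_exists,
      not_le, hDk0, mul_zero, sub_zero] at hcon
    refine absurd hω (not_lt.2 (Real.le_sqrt_of_sq_le ?_))
    rw [EuclideanSpace.real_norm_sq_eq]
    calc _ ≤ ∑ _k : Fin p, x ^ 2 := Finset.sum_le_sum fun k _ => ?_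
      _ = _ := by simp
    have h1 := (hcon k).le
    rw [PiLp.smul_apply, WithLp.ofLp_sum, Finset.sum_apply, smul_eq_mul]
    rw [← sq_abs, abs_mul, abs_inv, abs_of_pos hsq]
    exact pow_le_pow_left₀ (by positivity) ((inv_mul_le_iff₀ hsq).2 h1) 2
  calc _ ≤ _ := measure_mono hsub
    _ ≤ ∑ k, P {ω | √(n : ℝ) * x ≤
        |∑ i ∈ Finset.range n, D (Y i ω) k - n * ∫ y, D y k ∂F|} := measure_biUnion_finset_le _ _
    _ ≤ ∑ k, ENNReal.ofReal (n * variance (fun y => D y k) F / (√(n : ℝ) * x) ^ 2) :=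
        Finset.sum_le_sum fun k _ =>
          measure_abs_sum_sub_ge_le hYmeas hYlaw hYindep (hDk k) n (mul_pos hsq hx0)
    _ = ENNReal.ofReal (V / x ^ 2) := by
        rw [hV, Finset.sum_div, ENNReal.ofReal_sum_of_nonneg
          fun k _ => div_nonneg (variance_nonneg _ _) (sq_nonneg _)]
        refine Finset.sum_congr rfl fun k _ => ?_
        rw [mul_pow, Real.sq_sqrt hn'.le, mul_div_mul_left _ _ hn'.ne']
    _ ≤ η := hx

variable {f : 𝒴 → EuclideanSpace ℝ (Fin p) → ℝ} {θ₀ : EuclideanSpace ℝ (Fin p)}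
  {D : 𝒴 → EuclideanSpace ℝ (Fin p)} {J : Matrix (Fin p) (Fin p) ℝ}

/-- The bias is eventually below δ/2 by the mean expansion, and Chebyshev bounds the fluctuation by
n Var R / (δ/2)², which tends to 0. -/
theorem tendsto_measure_sum_remainder_ge (hYmeas : ∀ i, Measurable (Y i))
    (hYlaw : ∀ i, P.map (Y i) = F) (hYindep : iIndepFun Y P)
    (hRmem : ∀ᶠ t in 𝓝 (0 : EuclideanSpace ℝ (Fin p)),
      MemLp (fun y => remainder f θ₀ D y t) 2 F)
    (hRmean : (fun t : EuclideanSpace ℝ (Fin p) =>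
        ∫ y, remainder f θ₀ D y t ∂F + 1 / 2 * (t.ofLp ⬝ᵥ (J *ᵥ t.ofLp)))
      =o[𝓝 0] fun t => ‖t‖ ^ 2)
    (hRvar : (fun t : EuclideanSpace ℝ (Fin p) =>
        variance (fun y => remainder f θ₀ D y t) F)
      =o[𝓝 0] fun t => ‖t‖ ^ 2) (s : EuclideanSpace ℝ (Fin p)) {δ : ℝ} (hδ : 0 < δ) :
    Tendsto (fun n : ℕ => P {ω | δ ≤
      |∑ i ∈ Finset.range n, remainder f θ₀ D (Y i ω) ((√(n : ℝ))⁻¹ • s) +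
        1 / 2 * (s.ofLp ⬝ᵥ (J *ᵥ s.ofLp))|}) atTop (𝓝 0) := by
  have hmean := tendsto_natCast_mul_of_isLittleO hRmean s
  have hvar : Tendsto (fun n : ℕ => ENNReal.ofReal (n * variance
      (fun y => remainder f θ₀ D y ((√(n : ℝ))⁻¹ • s)) F / (δ / 2) ^ 2)) atTop (𝓝 0) := by
    rw [← ENNReal.ofReal_zero, ← zero_div ((δ / 2) ^ 2)]
    exact ENNReal.tendsto_ofReal ((tendsto_natCast_mul_of_isLittleO hRvar s).div_const _)
  refine tendsto_of_tendsto_of_tendsto_of_le_of_le' tendsto_const_nhds hvar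
    (Eventually.of_forall fun _ => zero_le) ?_
  filter_upwards [(tendsto_inv_sqrt_smul s).eventually hRmem,
    Metric.tendsto_nhds.1 hmean (δ / 2) (half_pos hδ), eventually_gt_atTop 0] with n hn hm hn0
  refine le_trans (measure_mono fun ω hω => ?_)
    (measure_abs_sum_sub_ge_le hYmeas hYlaw hYindep hn n (half_pos hδ))
  rw [dotProduct_mulVec_smul, inv_pow, Real.sq_sqrt (Nat.cast_nonneg n), mul_add,
    dist_zero_right, Real.norm_eq_abs] at hm
  have hn' : (n : ℝ) ≠ 0 := Nat.cast_ne_zero.2 hn0.ne'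
  have e : (n : ℝ) * (1 / 2 * ((n : ℝ)⁻¹ * (s.ofLp ⬝ᵥ (J *ᵥ s.ofLp)))) =
      1 / 2 * (s.ofLp ⬝ᵥ (J *ᵥ s.ofLp)) := by field_simp
  rw [e] at hm
  simp only [Set.mem_ofPred_eq] at hω ⊢
  set S := ∑ i ∈ Finset.range n, remainder f θ₀ D (Y i ω) ((√(n : ℝ))⁻¹ • s)
  have tri := abs_add_le (S - n * ∫ y, remainder f θ₀ D y ((√(n : ℝ))⁻¹ • s) ∂F)
    (n * (∫ y, remainder f θ₀ D y ((√(n : ℝ))⁻¹ • s) ∂F) + 1 / 2 * (s.ofLp ⬝ᵥ (J *ᵥ s.ofLp)))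
  rw [← add_assoc, sub_add_cancel] at tri
  linarith

end Probability

theorem tendsto_measure_not_closeEstimates {Ω 𝒴 : Type*} [MeasurableSpace Ω] [MeasurableSpace 𝒴]
    {p : ℕ} {P : Measure Ω} [IsProbabilityMeasure P] {F : Measure 𝒴} {Y : ℕ → Ω → 𝒴}
    (hYmeas : ∀ i, Measurable (Y i)) (hYlaw : ∀ i, P.map (Y i) = F) (hYindep : iIndepFun Y P)
    {Θ : Set (EuclideanSpace ℝ (Fin p))} (hΘopen : IsOpen Θ) (hΘconv : Convex ℝ Θ)
    {f : 𝒴 → EuclideanSpace ℝ (Fin p) → ℝ}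
    (hfnn : ∀ y, ∀ θ ∈ Θ, 0 ≤ f y θ) (hfconc : ∀ y, LogConcaveOn Θ (f y))
    {θ₀ : EuclideanSpace ℝ (Fin p)} (hθ₀ : θ₀ ∈ Θ)
    (hfpos : ∀ᶠ t in 𝓝 (0 : EuclideanSpace ℝ (Fin p)), ∀ᵐ y ∂F, 0 < f y (θ₀ + t))
    {D : 𝒴 → EuclideanSpace ℝ (Fin p)} (hDcov : MemLp D 2 F) (hDmean : ∫ y, D y ∂F = 0)
    {J : Matrix (Fin p) (Fin p) ℝ} (hJ : J.PosDef)
    (hRmem : ∀ᶠ t in 𝓝 (0 : EuclideanSpace ℝ (Fin p)),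
      MemLp (fun y => remainder f θ₀ D y t) 2 F)
    (hRmean : (fun t : EuclideanSpace ℝ (Fin p) =>
        ∫ y, remainder f θ₀ D y t ∂F + 1 / 2 * (t.ofLp ⬝ᵥ (J *ᵥ t.ofLp)))
      =o[𝓝 0] fun t => ‖t‖ ^ 2)
    (hRvar : (fun t : EuclideanSpace ℝ (Fin p) =>
        variance (fun y => remainder f θ₀ D y t) F)
      =o[𝓝 0] fun t => ‖t‖ ^ 2)
    {prior : EuclideanSpace ℝ (Fin p) → ℝ}
    (hpmeas : AEMeasurable prior (volume.restrict Θ))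
    (hpnonneg : ∀ θ ∈ Θ, 0 ≤ prior θ)
    (hpcont : ContinuousAt prior θ₀) (hppos : 0 < prior θ₀)
    {C₁ C₂ : ℝ} (hC₁ : 0 < C₁) (hC₂ : 0 < C₂)
    (hpgrowth : ∀ θ ∈ Θ, prior θ ≤ C₁ * Real.exp (C₂ * ‖θ‖)) {ε : ℝ} (hε : 0 < ε) :
    Tendsto (fun n => P {ω | ¬ CloseEstimates Θ f prior ε n (fun i => Y i ω)}) atTop (𝓝 0) := by
  have hF : IsProbabilityMeasure F :=
    hYlaw 0 ▸ Measure.isProbabilityMeasure_map (hYmeas 0).aemeasurable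
  obtain ⟨q, hq, hqT⟩ := exists_denseRange_convexHull (EuclideanSpace ℝ (Fin p))
  rw [ENNReal.tendsto_nhds_zero]
  intro η hη
  obtain ⟨K, hK⟩ := exists_measure_norm_score_gt_le hYmeas hYlaw hYindep hDcov hDmean
    (ENNReal.half_pos hη.ne')
  obtain ⟨N, hN⟩ := exists_closeEstimates_of_quadraticError hΘopen hΘconv hfnn hfconc hθ₀ hJ hpmeas
    hpnonneg hpcont hppos hC₁ hC₂ hpgrowth hq hqT K hε
  have hδ : (0 : ℝ) < ((N : ℝ) + 1)⁻¹ := by positivity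
  have hsum := tendsto_finsetSum (Finset.range N) fun j _ =>
    tendsto_measure_sum_remainder_ge hYmeas hYlaw hYindep hRmem hRmean hRvar (q j) hδ
  rw [Finset.sum_const_zero] at hsum
  have hpos : ∀ᶠ n : ℕ in atTop, ∀ j ∈ Finset.range N,
      ∀ᵐ y ∂F, 0 < f y (θ₀ + (√(n : ℝ))⁻¹ • q j) :=
    (Filter.eventually_all_finset _).2 fun j _ => (tendsto_inv_sqrt_smul (q j)).eventually hfpos
  have hpos0 : ∀ᵐ ω ∂P, ∀ i, 0 < f (Y i ω) θ₀ :=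
    ae_forall_comp hYmeas hYlaw (by simpa using hfpos.self_of_nhds)
  filter_upwards [eventually_gt_atTop N, hpos,
    hsum.eventually (ge_mem_nhds (ENNReal.half_pos hη.ne'))] with n hn hp hs
  have hp' : ∀ᵐ ω ∂P, ∀ j ∈ Finset.range N, ∀ i, 0 < f (Y i ω) (θ₀ + (√(n : ℝ))⁻¹ • q j) :=
    (Filter.eventually_all_finset _).2 fun j hj => ae_forall_comp hYmeas hYlaw (hp j hj)
  calc P {ω | ¬ CloseEstimates Θ f prior ε n (fun i => Y i ω)}
      ≤ P ({ω | K < ‖(√(n : ℝ))⁻¹ • ∑ i ∈ Finset.range n, D (Y i ω)‖} ∪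
          ⋃ j ∈ Finset.range N, {ω | ((N : ℝ) + 1)⁻¹ ≤
            |∑ i ∈ Finset.range n, remainder f θ₀ D (Y i ω) ((√(n : ℝ))⁻¹ • q j) +
              1 / 2 * ((q j).ofLp ⬝ᵥ (J *ᵥ (q j).ofLp))|}) := by
        -- Positivity of the densities holds only almost surely, with a null set for each point;
        -- finitely many points are involved.
        refine measure_mono_ae ?_
        filter_upwards [hpos0, hp'] with ω h0 hj hbad
        by_contra hgood
        change ω ∉ (_ ∪ _ : Set Ω) at hgood
        simp only [Set.mem_union, Set.mem_ofPred_eq, Set.mem_iUnion, Finset.mem_range, not_or,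
          not_exists, not_lt, not_le] at hgood
        refine hbad (hN n hn _ _ hgood.1 (Finset.prod_pos fun i _ => h0 i)
          (fun j hjN => Finset.prod_pos fun i _ => hj j (Finset.mem_range.2 hjN) i)
          fun j hjN => ?_)
        rw [quadraticError_eq_sum_remainder h0 (hj j (Finset.mem_range.2 hjN))]
        exact hgood.2 j hjN
    _ ≤ η / 2 + η / 2 := (measure_union_le _ _).trans (add_le_add
        (hK n ((Nat.zero_le N).trans_lt hn)) ((measure_biUnion_finset_le _ _).trans hs))
    _ = η := ENNReal.add_halves η

end BayesML


theorem theorem4p2 {Ω 𝒴 : Type*} [MeasurableSpace Ω] [MeasurableSpace 𝒴] {p : ℕ}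
    (P : Measure Ω) [IsProbabilityMeasure P]
    -- i.i.d. observations with true density `f₀` with respect to `ν`
    (ν : Measure 𝒴) (f₀ : 𝒴 → ℝ) (hf₀ : BayesML.IsProbDensity ν f₀)
    (F : Measure 𝒴) (hF : F = ν.withDensity (fun y => ENNReal.ofReal (f₀ y)))
    (Y : ℕ → Ω → 𝒴) (hYmeas : ∀ i, Measurable (Y i))
    (hYlaw : ∀ i, P.map (Y i) = F) (hYindep : iIndepFun Y P)
    -- the parametric log-concave model; `f₀` need not belong to it
    (Θ : Set (EuclideanSpace ℝ (Fin p))) (hΘopen : IsOpen Θ) (hΘconv : Convex ℝ Θ)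
    (f : 𝒴 → EuclideanSpace ℝ (Fin p) → ℝ)
    (hfdens : ∀ θ ∈ Θ, BayesML.IsProbDensity ν (fun y => f y θ))
    (hfconc : ∀ y, BayesML.LogConcaveOn Θ (f y))
    -- the expansion at `θ₀`
    (θ₀ : EuclideanSpace ℝ (Fin p)) (hθ₀ : θ₀ ∈ Θ)
    (hfpos : ∀ᶠ t in 𝓝 (0 : EuclideanSpace ℝ (Fin p)), ∀ᵐ y ∂F, 0 < f y (θ₀ + t))
    (D : 𝒴 → EuclideanSpace ℝ (Fin p)) (hDcov : MemLp D 2 F) (hDmean : ∫ y, D y ∂F = 0)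
    (J : Matrix (Fin p) (Fin p) ℝ) (hJ : J.PosDef)
    (hRmem : ∀ᶠ t in 𝓝 (0 : EuclideanSpace ℝ (Fin p)),
      MemLp (fun y => BayesML.remainder f θ₀ D y t) 2 F)
    (hRmean : (fun t : EuclideanSpace ℝ (Fin p) =>
        ∫ y, BayesML.remainder f θ₀ D y t ∂F + 1 / 2 * (t.ofLp ⬝ᵥ (J *ᵥ t.ofLp)))
      =o[𝓝 0] fun t => ‖t‖ ^ 2)
    (hRvar : (fun t : EuclideanSpace ℝ (Fin p) =>
        variance (fun y => BayesML.remainder f θ₀ D y t) F)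
      =o[𝓝 0] fun t => ‖t‖ ^ 2)
    -- the prior density, possibly improper
    (prior : EuclideanSpace ℝ (Fin p) → ℝ)
    (hpmeas : AEMeasurable prior (volume.restrict Θ))
    (hpnonneg : ∀ θ ∈ Θ, 0 ≤ prior θ)
    (hpcont : ContinuousAt prior θ₀) (hppos : 0 < prior θ₀)
    (C₁ C₂ : ℝ) (hC₁ : 0 < C₁) (hC₂ : 0 < C₂)
    (hpgrowth : ∀ θ ∈ Θ, prior θ ≤ C₁ * Real.exp (C₂ * ‖θ‖))
    -- `θhat n` maximises the likelihood whenever a maximiser exists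
    (θhat : ℕ → Ω → EuclideanSpace ℝ (Fin p))
    (hθhat : ∀ n, ∀ᵐ ω ∂P, (∃ θ, BayesML.IsMLE Θ f n (fun i => Y i ω) θ) →
      BayesML.IsMLE Θ f n (fun i => Y i ω) (θhat n ω)) :
    Tendsto (fun n => P {ω | ¬ BayesML.IsMLE Θ f n (fun i => Y i ω) (θhat n ω)})
      atTop (𝓝 0) ∧
    Tendsto (fun n => P {ω | ¬ BayesML.PosteriorMeanExists Θ f prior n (fun i => Y i ω)})
      atTop (𝓝 0) ∧
    TendstoInMeasure P
      (fun (n : ℕ) ω => Real.sqrt n •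
        (BayesML.posteriorMean Θ f prior n (fun i => Y i ω) - θhat n ω))
      atTop (fun _ => 0) := by
  have hclose := fun {ε : ℝ} (hε : 0 < ε) =>
    BayesML.tendsto_measure_not_closeEstimates hYmeas hYlaw hYindep hΘopen hΘconv
      (fun y θ hθ => (hfdens θ hθ).2.1 y) hfconc hθ₀ hfpos hDcov hDmean hJ hRmem hRmean hRvar
      hpmeas hpnonneg hpcont hppos hC₁ hC₂ hpgrowth hε
  refine ⟨?_, ?_, tendstoInMeasure_iff_norm.2 fun ε hε => ?_⟩
  -- Only existence of a maximiser is used, so the tolerance 1 is arbitrary.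
  · refine tendsto_of_tendsto_of_tendsto_of_le_of_le tendsto_const_nhds (hclose one_pos)
      (fun _ => zero_le) fun n => measure_mono_ae ?_
    filter_upwards [hθhat n] with ω hω hbad hgood
    exact hbad (hω hgood.1)
  · exact tendsto_of_tendsto_of_tendsto_of_le_of_le tendsto_const_nhds (hclose one_pos)
      (fun _ => zero_le) fun n => measure_mono fun ω hbad hgood => hbad hgood.2.1
  · refine tendsto_of_tendsto_of_tendsto_of_le_of_le tendsto_const_nhds (hclose hε)
      (fun _ => zero_le) fun n => measure_mono_ae ?_
    filter_upwards [hθhat n] with ω hω hbad hgood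
    have h := hgood.2.2 _ (hω hgood.1)
    refine absurd h (not_lt.2 ?_)
    rw [← sub_zero (√(n : ℝ) • _)]
    exact hbad
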